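/- **Setting.** Let $R$ be a commutative $\mathbb{Q}$-algebra with a complete Hausdorff ring topology in which $0$ has a basis of neighbourhoods consisting of $\mathbb{Q}$-subspaces, with a continuous derivation $\partial$, a continuous involution $f\mapsto\bar f$ (a ring automorphism of order two commuting with $\partial$), an invertible element $\varepsilon$ with $\partial\varepsilon=0$, $\bar\varepsilon=\varepsilon$, and an element $\tau$ with $\partial\tau=0$, $\bar\tau=-\tau$. Assume that $\varepsilon^n\partial^nf\to0$ for all $f\in R$, so that power series in $\varepsilon\partial$ with rational coefficients act on $R$. Put $\mathsf{E}^{s}=\exp(s\varepsilon\partial)$, $\nabla=\varepsilon^{-1}(\mathsf{E}^{1/2}-\mathsf{E}^{-1/2})$, and $\mathsf{P}=\partial\nabla^{-1}=\varepsilon\partial/(\mathsf{E}^{1/2}-\mathsf{E}^{-1/2})=1-\tfrac1{24}\varepsilon^2\partial^2+\cdots$. Difference operators are formal series $\sum_k p_k\Lambda^k$, $p_k\in R$, with $p_k=0$ for $k\gg0$ or with $p_k=0$ for $k\ll0$; operators of the same kind are multiplied by $$a\Lambda^i\cdot b\Lambda^j=(\mathsf{E}^{-j/2}a)(\mathsf{E}^{i/2}b)\Lambda^{i+j}.$$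 Scalar multiples and $\partial$ of an operator are taken coefficientwise, and $A_-$ is the part of $A$ with negative powers of $\Lambda$. Let $q,w_1,w_2,\ldots\in R$ with $\bar q=q$, and put $W=1+\sum_{k\ge1}w_k\Lambda^{-k}$, $L^m=W\Lambda^mW^{-1}=\sum_jp_j(m)\Lambda^j$ for $m\in\mathbb{Z}$, $L=L^1$, $v=p_0(1)$, $K=\Lambda+v+q\Lambda^{-1}$, $\ell=\log\Lambda-\log L=\varepsilon(\partial W)W^{-1}$, and $$z_k=p_{-1}(k)-q\,p_1(k)-\tau\,\mathsf{P}\,p_0(k),\qquad k\ge1 .$$ If $q$ is invertible, the conjugate of $\sum_k p_k\Lambda^k$ is $\sum_k\bar p_kq^{[k]}\Lambda^{-k}$, where $q^{[0]}=1$, $q^{[k+1]}=(\mathsf{E}^{k/2}q)(\mathsf{E}^{-1/2}q^{[k]})$ for $k\ge0$ and $q^{[-k]}=(q^{[k]})^{-1}$; let $\bar L$ be the conjugate of $L$. The negative part of a conjugate involves only $q^{[k]}$ with $k>0$, and so makes sense for all $q$; for instance $\bar L_-=q\Lambda^{-1}$. Let $\mathcal{B}$ be the free differential algebra over $\mathbb{Q}[\varepsilon,\varepsilon^{-1}]$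 on generators $q,w_k,\bar w_k$ $(k\ge1)$, mapped to $R$ by the given elements and their conjugates. The flows $\partial_1,\bar\partial_1$ are the evolutionary derivations $\mathcal{B}\to R$ along this map (killing $\varepsilon$ and commuting with $\partial$) that are conjugate to each other and determined by $$\varepsilon\partial_1W+L_-W=0,\qquad \varepsilon\bar\partial_1W+\bar L_-W=0,\qquad \partial_1q=q\nabla v,\qquad \bar\partial_1q=q\nabla\bar v .$$ **Theorem.** 1. The constraint $\varepsilon^{-1}[K,L]=\tau\partial L$ holds if and only if all $z_k$ are constants, $\partial z_k=0$, and $$K=L+\tau\ell-\sum_{k=1}^\infty\frac{z_k}{k}L^{-k}.\qquad(*)$$ 2. Suppose that $q$ is invertible. The two constraints of the equivariant Toda lattice, $\varepsilon^{-1}[K,L]=\tau\partial L$ and $\varepsilon^{-1}[K,\bar L]=\tau\partial\bar L$, both hold if and only if $\tau\partial q=q\nabla(v-\bar v)$, all $z_k$ are constants, and $(*)$ holds. 3. One has $\varepsilon^{-1}[K,L]=\tau\partial L$ and $z_k=0$ for all $k\ge1$ if and only if $(\partial_1-\bar\partial_1)W=\tau\partial W$. In particular, if $\varepsilon^{-1}[K,L]=\tau\partial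 L$, then the $z_k$ all vanish exactly when $(\partial_1-\bar\partial_1)W=\tau\partial W$. 4. Suppose that $q$ is invertible. Both constraints hold and $z_k=0$ for all $k\ge1$ if and only if $\partial_1-\bar\partial_1=\tau\partial$ on $\mathcal{B}$ (as maps from $\mathcal{B}$ to $R$). -/

import Mathlib

open Filter Topology

noncomputable section

namespace Toda

/-- A differential algebra with involution `star`, with an invertible formal lattice spacing `ε` and
a parameter `τ`. The last field says that the spacing is infinitesimal: the series
`exp (s ε ∂)`, and every other rational power series in `ε ∂`, can be applied to all elements. -/
structure DiffAlg (R : Type*) [CommRing R] [Algebra ℚ R] [TopologicalSpace R] [StarRing R] where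
  ε : Rˣ
  τ : R
  der : Derivation ℚ R R
  continuous_der : Continuous der
  der_star : ∀ f, der (star f) = star (der f)
  der_eps : der (ε : R) = 0
  star_eps : star (ε : R) = ε
  der_tau : der τ = 0
  star_tau : star τ = -τ
  tendsto_zero : ∀ f, Tendsto (fun n : ℕ => (ε : R) ^ n * der^[n] f) atTop (𝓝 0)

variable {R : Type*} [CommRing R] [Algebra ℚ R] [TopologicalSpace R] [StarRing R]

namespace DiffAlg

variable (A : DiffAlg R)

/-- The operator `c(ε ∂)` for a power series `c` with rational coefficients. -/
def op (c : PowerSeries ℚ) (f : R) : R :=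
  ∑' n : ℕ, PowerSeries.coeff n c • ((A.ε : R) ^ n * A.der^[n] f)

/-- `shift m` is the half-integral shift `E ^ (m / 2) = exp (m ε ∂ / 2)`. -/
def shift (m : ℤ) (f : R) : R :=
  A.op (PowerSeries.rescale ((m : ℚ) / 2) (PowerSeries.exp ℚ)) f

/-- `∇ = ε⁻¹ (E ^ (1/2) - E ^ (-1/2))`. -/
def nabla (f : R) : R := ((A.ε⁻¹ : Rˣ) : R) * (A.shift 1 f - A.shift (-1) f)

/-- The power series `(exp (x / 2) - exp (-x / 2)) / x = 1 + x ^ 2 / 24 + ⋯`. -/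
def sinhc : PowerSeries ℚ :=
  PowerSeries.mk fun n => PowerSeries.coeff (n + 1)
    (PowerSeries.rescale (1 / 2 : ℚ) (PowerSeries.exp ℚ) -
      PowerSeries.rescale (-1 / 2 : ℚ) (PowerSeries.exp ℚ))

lemma X_mul_sinhc : PowerSeries.X * sinhc =
    PowerSeries.rescale (1 / 2 : ℚ) (PowerSeries.exp ℚ) -
      PowerSeries.rescale (-1 / 2 : ℚ) (PowerSeries.exp ℚ) := by
  ext n
  rcases n with _ | n
  · simp only [PowerSeries.coeff_zero_X_mul, map_sub, PowerSeries.coeff_rescale]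
    simp
  · simp [sinhc, PowerSeries.coeff_succ_X_mul]

lemma sinhc_mul_inv : sinhc * sinhc⁻¹ = 1 := by
  apply PowerSeries.mul_inv_cancel
  have : PowerSeries.constantCoeff sinhc = 1 := by
    rw [← PowerSeries.coeff_zero_eq_constantCoeff_apply]
    simp [sinhc, PowerSeries.coeff_rescale, PowerSeries.coeff_exp]
    norm_num
  simp [this]

/-- `P = ∂ ∇⁻¹`, that is `ε ∂ / (E ^ (1/2) - E ^ (-1/2))` as a power series in `ε ∂`. -/
def P (f : R) : R := A.op sinhc⁻¹ f

/-- The product of difference operators; `a : ℤ → R` stands for `∑ a k Λ ^ k`. It is used only when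
both factors lie in `IsMinus`, or both in `IsPlus`, and then the sums are finite. -/
def comp (a b : ℤ → R) : ℤ → R := fun k =>
  ∑ᶠ i : ℤ, A.shift (i - k) (a i) * A.shift i (b (k - i))

/-- The commutator of two difference operators. -/
def comm (a b : ℤ → R) : ℤ → R := A.comp a b - A.comp b a

end DiffAlg

/-- The coefficients of an element of `Φ₋`. -/
def IsMinus (a : ℤ → R) : Prop := ∃ N : ℤ, ∀ k, N < k → a k = 0

/-- The coefficients of an element of `Φ₊`. -/
def IsPlus (a : ℤ → R) : Prop := ∃ N : ℤ, ∀ k, k < N → a k = 0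

/-- The negative part `a₋` of a difference operator. -/
def negPart (a : ℤ → R) : ℤ → R := fun k => if k < 0 then a k else 0

namespace DiffAlg

variable (A : DiffAlg R)

lemma shift_zero_right (m : ℤ) : A.shift m 0 = 0 := by
  have h : ∀ n : ℕ, A.der^[n] (0 : R) = 0 := fun n => iterate_map_zero A.der n
  simp [shift, op, h]

lemma comp_finite {a b : ℤ → R} (h : (IsMinus a ∧ IsMinus b) ∨ (IsPlus a ∧ IsPlus b)) (k : ℤ) :
    (Function.support fun i : ℤ => A.shift (i - k) (a i) * A.shift i (b (k - i))).Finite := by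
  rcases h with ⟨⟨N, hN⟩, ⟨M, hM⟩⟩ | ⟨⟨N, hN⟩, ⟨M, hM⟩⟩
  · refine (Set.finite_Icc (k - M) N).subset fun i hi => ?_
    by_contra hc
    rw [Set.mem_Icc, not_and_or, not_le, not_le] at hc
    apply hi
    rcases hc with hc | hc
    · simp [hM (k - i) (by omega), shift_zero_right]
    · simp [hN i hc, shift_zero_right]
  · refine (Set.finite_Icc N (k - M)).subset fun i hi => ?_
    by_contra hc
    rw [Set.mem_Icc, not_and_or, not_le, not_le] at hc
    apply hi
    rcases hc with hc | hc
    · simp [hN i hc, shift_zero_right]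
    · simp [hM (k - i) (by omega), shift_zero_right]

lemma comp_eq_zero {a b : ℤ → R} {N M : ℤ} (ha : ∀ k, N < k → a k = 0)
    (hb : ∀ k, M < k → b k = 0) {k : ℤ} (hk : N + M < k) : A.comp a b k = 0 := by
  unfold comp
  apply finsum_eq_zero_of_forall_eq_zero
  intro i
  by_cases h : N < i
  · simp [ha i h, shift_zero_right]
  · simp [hb (k - i) (by omega), shift_zero_right]

end DiffAlg

/-- The data of the Toda lattice in a differential algebra: the element `q = star q` and the
coefficients of the dressing operator. Here `w k` is the coefficient of `Λ ^ (-(k + 1))`, that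
is, the element usually written with the index `k + 1`; the conjugate generators are `star (w k)`. -/
structure Data (A : DiffAlg R) where
  q : R
  star_q : star q = q
  w : ℕ → R

namespace Data

variable {A : DiffAlg R} (T : Data A)

/-- The operator `Λ ^ m`. -/
def Lam (m : ℤ) : ℤ → R := Pi.single m 1

/-- The dressing operator `W = 1 + w₁ Λ⁻¹ + w₂ Λ⁻² + ⋯`. -/
def W : ℤ → R
  | Int.ofNat 0 => 1
  | Int.ofNat (_ + 1) => 0
  | Int.negSucc k => T.w k

/-- `winv k` is the coefficient of `Λ ^ (-(k + 1))` in `W⁻¹`. -/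
def winv (T : Data A) (k : ℕ) : R :=
  -T.w k - ∑ i : Fin k, A.shift ((k : ℤ) - i) (T.w i) *
    A.shift (-((i : ℤ) + 1)) (winv T (k - 1 - i))
termination_by k
decreasing_by omega

/-- The inverse `W⁻¹` of the dressing operator. -/
def Winv : ℤ → R
  | Int.ofNat 0 => 1
  | Int.ofNat (_ + 1) => 0
  | Int.negSucc k => T.winv k

/-- The integral powers `L ^ m = W Λ ^ m W⁻¹` of the Lax operator. -/
def Lpow (m : ℤ) : ℤ → R := A.comp (A.comp T.W (Lam m)) T.Winv

/-- The Lax operator `L = W Λ W⁻¹ = Λ + a₁ + a₂ Λ⁻¹ + ⋯`. -/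
def L : ℤ → R := T.Lpow 1

/-- `v = a₁`. -/
def v : R := T.L 0

/-- `K = Λ + v + q Λ⁻¹`. -/
def K : ℤ → R := Pi.single 1 1 + Pi.single 0 T.v + Pi.single (-1) T.q

/-- `q ^ [k]`, for `k ≥ 0`; this is `(q Λ⁻¹) ^ k = q ^ [k] Λ ^ (-k)`. -/
def qPow (T : Data A) : ℕ → R
  | 0 => 1
  | k + 1 => A.shift k T.q * A.shift (-1) (qPow T k)

/-- The conjugation of difference operators, an anti-isomorphism of `Φ₋` and `Φ₊` when `q` is
invertible: `p Λ ^ k` goes to `star p q ^ [k] Λ ^ (-k)`, with `q ^ [-k] = (q ^ [k])⁻¹`. -/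
def conj (a : ℤ → R) : ℤ → R
  | Int.ofNat k => star (a (-(k : ℤ))) * Ring.inverse (T.qPow k)
  | Int.negSucc k => star (a ((k : ℤ) + 1)) * T.qPow (k + 1)

/-- The conjugate Lax operator. -/
def Lbar : ℤ → R := T.conj T.L

/-- `ℓ = log Λ - log L = ε (∂ W) W⁻¹`, where `log L = W (log Λ) W⁻¹` and `[log Λ, f] = ε ∂ f`. -/
def ell : ℤ → R := A.comp (fun n => (A.ε : R) * A.der (T.W n)) T.Winv

/-- `z k = p₋₁(k) - q p₁(k) - τ P p₀(k)`, where `L ^ k = ∑ pⱼ(k) Λ ^ j`; only `k ≥ 1` is used. -/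
def z (k : ℕ) : R := T.Lpow k (-1) - T.q * T.Lpow k 1 - A.τ * A.P (T.Lpow k 0)

lemma W_of_pos {k : ℤ} (hk : 0 < k) : T.W k = 0 := by
  obtain ⟨n, rfl⟩ := Int.eq_succ_of_zero_lt hk
  rfl

lemma Winv_of_pos {k : ℤ} (hk : 0 < k) : T.Winv k = 0 := by
  obtain ⟨n, rfl⟩ := Int.eq_succ_of_zero_lt hk
  rfl

lemma Lpow_eq_zero {m k : ℤ} (hk : m < k) : T.Lpow m k = 0 := by
  refine A.comp_eq_zero (N := m) (M := 0) (fun i hi => ?_) (fun i hi => T.Winv_of_pos hi)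
    (by omega)
  refine A.comp_eq_zero (N := 0) (M := m) (fun j hj => T.W_of_pos hj) (fun j hj => ?_) (by omega)
  simp [Lam, show j ≠ m by omega]

/-- The series `∑_{k ≥ 1} (z k / k) L ^ (-k)`, in which the sum for each coefficient is finite. -/
def zSeries : ℤ → R := fun n =>
  ∑ᶠ k : ℕ, ((k : ℚ) + 1)⁻¹ • (T.z (k + 1) * T.Lpow (-((k : ℤ) + 1)) n)

lemma zSeries_finite (n : ℤ) : (Function.support fun k : ℕ =>
    ((k : ℚ) + 1)⁻¹ • (T.z (k + 1) * T.Lpow (-((k : ℤ) + 1)) n)).Finite := by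
  refine (Set.finite_Iio (-n).toNat).subset fun k hk => ?_
  by_contra hc
  rw [Set.mem_Iio, not_lt] at hc
  exact hk (by beta_reduce; rw [T.Lpow_eq_zero (show -((k : ℤ) + 1) < n by omega), mul_zero, smul_zero])

/-- The constraint `ε⁻¹ [K, L] = τ ∂ L`. -/
def ConstraintL : Prop :=
  ∀ n, ((A.ε⁻¹ : Rˣ) : R) * A.comm T.K T.L n = A.τ * A.der (T.L n)

/-- The constraint `ε⁻¹ [K, L̄] = τ ∂ L̄`. -/
def ConstraintLbar : Prop :=
  ∀ n, ((A.ε⁻¹ : Rˣ) : R) * A.comm T.K T.Lbar n = A.τ * A.der (T.Lbar n)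

/-- The identity `K = L + τ ℓ - ∑_{k ≥ 1} (z k / k) L ^ (-k)`. -/
def Identity : Prop := ∀ n, T.K n = T.L n + A.τ * T.ell n - T.zSeries n

/-! ### The free differential algebra of the dressing operator and its flows -/

/-- The generators of the free differential algebra `B`, with the same shift of the index as
in `Data.w`. -/
inductive Gen : Type
  | q : Gen
  | w (k : ℕ) : Gen
  | wbar (k : ℕ) : Gen

/-- The ring of coefficients `ℚ[ε, ε⁻¹]`. -/
abbrev Coeffs (A : DiffAlg R) : Subalgebra ℚ R :=
  Algebra.adjoin ℚ {(A.ε : R), ((A.ε⁻¹ : Rˣ) : R)}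

/-- The free differential algebra `B` of polynomials in the generators and their derivatives: the
variable `(g, n)` stands for the `n`th derivative of the generator `g`. -/
abbrev FreeAlg (A : DiffAlg R) : Type _ := MvPolynomial (Gen × ℕ) (Coeffs A)

/-- The values of the generators. -/
def genVal : Gen → R
  | Gen.q => T.q
  | Gen.w k => T.w k
  | Gen.wbar k => star (T.w k)

/-- The homomorphism of differential algebras from `B` that is given by the data. -/
def eval : FreeAlg A →ₐ[Coeffs A] R :=
  MvPolynomial.aeval fun p : Gen × ℕ => A.der^[p.2] (T.genVal p.1)

/-- The evolutionary derivation of `B`, with values taken along `eval`, that has the prescribed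
values on the generators: the derivation `X` that kills `ε`, commutes with `∂`, and
maps each generator `g` to `c g`. -/
def evol (c : Gen → R) (f : FreeAlg A) : R :=
  ∑ p ∈ f.vars, T.eval (MvPolynomial.pderiv p f) * A.der^[p.2] (c p.1)

/-- The operator `-ε⁻¹ (L ^ n)₋ W`. -/
def flowW (n : ℕ) : ℤ → R := fun k =>
  -(((A.ε⁻¹ : Rˣ) : R) * A.comp (negPart (T.Lpow n)) T.W k)

/-- The operator `-ε⁻¹ (L̄ ^ n)₋ W`, where `L̄ ^ n` is the conjugate of `L ^ n`. -/
def flowbarW (n : ℕ) : ℤ → R := fun k =>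
  -(((A.ε⁻¹ : Rˣ) : R) * A.comp (negPart (T.conj (T.Lpow n))) T.W k)

/-- The flow `∂_n` of the Toda lattice: `ε ∂_n W + (L ^ n)₋ W = 0`, `∂_n` is conjugate to `∂̄_n`,
and `∂_n q = q ∇ p₀(n)`. -/
def flow (n : ℕ) : FreeAlg A → R := T.evol fun
  | Gen.q => T.q * A.nabla (T.Lpow n 0)
  | Gen.w k => T.flowW n (Int.negSucc k)
  | Gen.wbar k => star (T.flowbarW n (Int.negSucc k))

/-- The flow `∂̄_n` of the Toda lattice: `ε ∂̄_n W + (L̄ ^ n)₋ W = 0`, `∂̄_n` is conjugate to `∂_n`,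
and `∂̄_n q = q ∇ (star p₀(n))`. -/
def flowbar (n : ℕ) : FreeAlg A → R := T.evol fun
  | Gen.q => T.q * A.nabla (star (T.Lpow n 0))
  | Gen.w k => T.flowbarW n (Int.negSucc k)
  | Gen.wbar k => star (T.flowW n (Int.negSucc k))

/-- The coefficients of the universal dressing operator, with coefficients in `B`. -/
def freeW : ℤ → FreeAlg A
  | Int.ofNat 0 => 1
  | Int.ofNat (_ + 1) => 0
  | Int.negSucc k => MvPolynomial.X (Gen.w k, 0)

lemma eval_freeW (k : ℤ) : T.eval (freeW k) = T.W k := by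
  rcases k with (_ | k) | k <;> simp [freeW, W, eval, genVal]

lemma evol_X (c : Gen → R) (p : Gen × ℕ) :
    T.evol c (MvPolynomial.X p) = A.der^[p.2] (c p.1) := by
  rcases subsingleton_or_nontrivial R with h | h
  · exact Subsingleton.elim _ _
  · simp [evol, MvPolynomial.vars_X]

lemma negPart_comp_W (a : ℤ → R) (k : ℕ) : A.comp (negPart a) T.W (Int.ofNat k) = 0 := by
  have h : (-1 : ℤ) + 0 < Int.ofNat k := by rw [Int.ofNat_eq_natCast]; omega
  refine A.comp_eq_zero (fun i hi => ?_) (fun i hi => T.W_of_pos hi) h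
  simp [negPart, show ¬ i < 0 by omega]

/-- The defining equation `ε ∂_n W + (L ^ n)₋ W = 0`. -/
lemma flow_freeW (n : ℕ) (k : ℤ) :
    (A.ε : R) * T.flow n (freeW k) + A.comp (negPart (T.Lpow n)) T.W k = 0 := by
  rcases k with k | k
  · rw [negPart_comp_W]
    rcases k with _ | k <;> simp [freeW, flow, evol]
  · simp [freeW, flow, evol_X, flowW]

/-- The defining equation `ε ∂̄_n W + (L̄ ^ n)₋ W = 0`. -/
lemma flowbar_freeW (n : ℕ) (k : ℤ) :
    (A.ε : R) * T.flowbar n (freeW k) + A.comp (negPart (T.conj (T.Lpow n))) T.W k = 0 := by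
  rcases k with k | k
  · rw [negPart_comp_W]
    rcases k with _ | k <;> simp [freeW, flowbar, evol]
  · simp [freeW, flowbar, evol_X, flowbarW]

end Data

end Toda

end

set_option linter.unusedSectionVars false

noncomputable section

namespace Toda

/-! Everything is conjugated back by the dressing operator. Since `∂Λ = 0`, differentiating `L = W Λ
W⁻¹` gives `ε ∂L = [ℓ, L]` (`epsDer_laxPow`), so the first constraint says that `K - τ ℓ` commutes
with `L`. Equivalently, `X = W⁻¹ (K - τ ℓ) W` (`undressed`) commutes with `Λ`. The commutator with
`Λ` acts on coefficients as `ε ∇`, and `P ∇ = ∂`, so this means that `X` has constant coefficients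
(`constraintL_iff`). As `v` is the constant coefficient of `L`, one has `X = Λ + ∑ x₋ₖ Λ⁻ᵏ`, and
conjugating forward expands `K - τ ℓ` in powers of `L`.

It remains to find `x₋ₖ = -zₖ/k`. The tool is the cocycle `c(a, b) = ∑ [i](aᵢ b₋ᵢ)` with quantum
integers `[i]`, for which `ε ∇ c(a, b)` is the constant coefficient of `[a, b]`. It is cyclic
(`cocycle_cyclic`), by the addition law for `[i + j]`, hence invariant under simultaneous
conjugation of commuting operators (`cocycle_conj`). Moreover `c(K, Lᵏ) = p₋₁(k) - q p₁(k)` and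
`c(ℓ, Lᵏ) = P p₀(k)` (`cocycle_epsDer_mul`), so `zₖ = c(K - τ ℓ, Lᵏ)` for `k ≥ 1` without any
constraint. Under the constraint this equals `c(X, Λᵏ) = -k x₋ₖ`.

For the second constraint, conjugation is an anti-isomorphism which changes `K` only by replacing
`v` with `v̄`. Given the first constraint, the second thus reduces to a formula for `τ ∂` of `q ^
[m]`, which follows from `τ ∂q = q ∇(v - v̄)`; conversely that equation is its coefficient of `Λ⁻¹`.

For the flows, the first constraint with all `zₖ = 0` means `X = Λ`, that is `K - L = τ ℓ`. As `K -
L = q Λ⁻¹ - L₋`, multiplying by `W` on the right gives the equation for `∂₁ - ∂̄₁` on `W`. On the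
free algebra it suffices to compare derivations on generators. -/

lemma nonarchimedeanRing_of_isLinearTopology (R : Type*) [CommRing R] [Algebra ℚ R]
    [TopologicalSpace R] [IsTopologicalRing R] [IsLinearTopology ℚ R] : NonarchimedeanRing R where
  is_nonarchimedean U hU := by
    obtain ⟨N, hN, hNU⟩ := (IsLinearTopology.hasBasis_open_submodule ℚ (M := R)).mem_iff.mp hU
    exact ⟨⟨N.toAddSubgroup, hN⟩, hNU⟩

/-! ### Power series in `ε ∂` acting on `R`. -/

namespace DiffAlg

variable {R : Type*} [CommRing R] [Algebra ℚ R] [UniformSpace R]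
    [IsUniformAddGroup R] [IsTopologicalRing R] [IsLinearTopology ℚ R] [CompleteSpace R]
    [T2Space R] [StarRing R] [ContinuousStar R] (A : DiffAlg R)

/-- The terms of the power series `c(ε ∂) f` tend to zero. -/
lemma summable_op (c : PowerSeries ℚ) (f : R) :
    Summable fun n : ℕ => PowerSeries.coeff n c • ((A.ε : R) ^ n * A.der^[n] f) := by
  have := nonarchimedeanRing_of_isLinearTopology R
  apply NonarchimedeanAddGroup.summable_of_tendsto_cofinite_zero
  rw [Nat.cofinite_eq_atTop, (IsLinearTopology.hasBasis_open_submodule ℚ (M := R)).tendsto_right_iff]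
  intro N hN
  filter_upwards [(A.tendsto_zero f).eventually (hN.mem_nhds (zero_mem N))] with n hn
  exact N.smul_mem _ hn

lemma op_add (c : PowerSeries ℚ) (f g : R) : A.op c (f + g) = A.op c f + A.op c g := by
  unfold op
  rw [← (A.summable_op c f).tsum_add (A.summable_op c g)]
  refine tsum_congr fun n => ?_
  rw [iterate_map_add, mul_add, smul_add]

/-- `c(ε ∂)` as an additive homomorphism. -/
def opHom (c : PowerSeries ℚ) : R →+ R := AddMonoidHom.mk' (A.op c) (A.op_add c)

lemma opHom_apply (c : PowerSeries ℚ) (f : R) : A.opHom c f = A.op c f := rfl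

lemma op_zero (c : PowerSeries ℚ) : A.op c 0 = 0 := map_zero (A.opHom c)

lemma op_sub (c : PowerSeries ℚ) (f g : R) : A.op c (f - g) = A.op c f - A.op c g :=
  map_sub (A.opHom c) f g

lemma op_series_add (c d : PowerSeries ℚ) (f : R) : A.op (c + d) f = A.op c f + A.op d f := by
  unfold op
  rw [← (A.summable_op c f).tsum_add (A.summable_op d f)]
  exact tsum_congr fun n => by rw [map_add, add_smul]

lemma op_series_neg (c : PowerSeries ℚ) (f : R) : A.op (-c) f = -A.op c f := by
  unfold op
  rw [← tsum_neg]
  exact tsum_congr fun n => by rw [map_neg, neg_smul]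

lemma op_series_sub (c d : PowerSeries ℚ) (f : R) : A.op (c - d) f = A.op c f - A.op d f := by
  rw [sub_eq_add_neg, op_series_add, op_series_neg, sub_eq_add_neg]

lemma der_const_mul {c : R} (hc : A.der c = 0) (f : R) : A.der (c * f) = c * A.der f := by
  simp [hc]

lemma der_iterate_const_mul {c : R} (hc : A.der c = 0) (n : ℕ) (f : R) :
    A.der^[n] (c * f) = c * A.der^[n] f := by
  induction n generalizing f with
  | zero => rfl
  | succ n ih => rw [Function.iterate_succ_apply, der_const_mul A hc, ih,
      Function.iterate_succ_apply]

lemma der_eps_pow (n : ℕ) : A.der ((A.ε : R) ^ n) = 0 := by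
  simp [Derivation.leibniz_pow, A.der_eps]

/-- Constants can be taken out of `c(ε ∂)`. -/
lemma op_const_mul (c : PowerSeries ℚ) {r : R} (hr : A.der r = 0) (f : R) :
    A.op c (r * f) = r * A.op c f := by
  unfold op
  rw [← (A.summable_op c f).tsum_mul_left]
  refine tsum_congr fun n => ?_
  rw [A.der_iterate_const_mul hr, mul_left_comm, mul_smul_comm]

/-- On constants, `c(ε ∂)` is multiplication by the constant term. -/
lemma op_of_der_eq_zero (c : PowerSeries ℚ) {f : R} (hf : A.der f = 0) :
    A.op c f = PowerSeries.coeff 0 c • f := by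
  unfold op
  rw [tsum_eq_single 0]
  · simp
  · intro n hn
    obtain ⟨n, rfl⟩ := Nat.exists_eq_succ_of_ne_zero hn
    rw [Function.iterate_succ_apply, hf, iterate_map_zero, mul_zero, smul_zero]

lemma op_der (c : PowerSeries ℚ) (f : R) : A.op c (A.der f) = A.der (A.op c f) := by
  unfold op
  rw [(A.summable_op c f).map_tsum A.der A.continuous_der]
  refine tsum_congr fun n => ?_
  rw [Derivation.map_smul, A.der_const_mul (A.der_eps_pow n), ← Function.iterate_succ_apply,
    Function.iterate_succ_apply']

lemma op_der_iterate (c : PowerSeries ℚ) (n : ℕ) (f : R) :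
    A.op c (A.der^[n] f) = A.der^[n] (A.op c f) := by
  induction n generalizing f with
  | zero => rfl
  | succ n ih => rw [Function.iterate_succ_apply, ih, op_der, ← Function.iterate_succ_apply]

lemma summable_op_op (c d : PowerSeries ℚ) (f : R) : Summable fun p : ℕ × ℕ =>
    (PowerSeries.coeff p.1 c * PowerSeries.coeff p.2 d) •
      ((A.ε : R) ^ (p.1 + p.2) * A.der^[p.1 + p.2] f) := by
  have := nonarchimedeanRing_of_isLinearTopology R
  apply NonarchimedeanAddGroup.summable_of_tendsto_cofinite_zero
  rw [(IsLinearTopology.hasBasis_open_submodule ℚ (M := R)).tendsto_right_iff]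
  intro N hN
  obtain ⟨M, hM⟩ := eventually_atTop.mp
    ((A.tendsto_zero f).eventually (hN.mem_nhds (zero_mem N)))
  -- Outside this box `p.1 + p.2 ≥ M`, and the term depends on the pair only through a rational
  -- factor and this sum.
  refine ((Set.finite_Iio M).prod (Set.finite_Iio M)).subset fun p hp => ?_
  by_contra hc
  refine hp (N.smul_mem _ (hM _ ?_))
  simp only [Set.mem_prod, Set.mem_Iio] at hc
  omega

/-- The operators `c(ε ∂)` form a representation of the algebra of power series. -/
lemma op_op (c d : PowerSeries ℚ) (f : R) : A.op c (A.op d f) = A.op (c * d) f := by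
  have hs := A.summable_op_op c d f
  have h1 : A.op c (A.op d f) = ∑' p : ℕ × ℕ,
      (PowerSeries.coeff p.1 c * PowerSeries.coeff p.2 d) •
        ((A.ε : R) ^ (p.1 + p.2) * A.der^[p.1 + p.2] f) := by
    have key (n m : ℕ) : (PowerSeries.coeff n c * PowerSeries.coeff m d) •
        ((A.ε : R) ^ (n + m) * A.der^[n + m] f) =
        PowerSeries.coeff n c • ((A.ε : R) ^ n *
          (PowerSeries.coeff m d • ((A.ε : R) ^ m * A.der^[m] (A.der^[n] f)))) := by
      rw [mul_smul, mul_smul_comm, ← mul_assoc, ← pow_add, ← Function.iterate_add_apply,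
        add_comm m n]
    have h (n : ℕ) : HasSum (fun m : ℕ => (PowerSeries.coeff n c * PowerSeries.coeff m d) •
        ((A.ε : R) ^ (n + m) * A.der^[n + m] f))
        (PowerSeries.coeff n c • ((A.ε : R) ^ n * A.der^[n] (A.op d f))) := by
      simp_rw [key]
      rw [← op_der_iterate]
      -- The rational scalar is turned into a ring element, so that multiplying a convergent series
      -- by a fixed element covers it too.
      simp only [Algebra.smul_def (_ : ℚ) ((A.ε : R) ^ n * _)]
      exact ((A.summable_op d (A.der^[n] f)).hasSum.mul_left _).mul_left _
    rw [hs.tsum_prod' fun n => (h n).summable]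
    exact tsum_congr fun n => (h n).tsum_eq.symm
  -- Regrouping by total degree produces the Cauchy product coefficients of `c * d`.
  rw [h1, ← Finset.HasAntidiagonal.sigmaAntidiagonalEquivProd.tsum_eq (_ : ℕ × ℕ → R)]
  have hs' := Finset.HasAntidiagonal.sigmaAntidiagonalEquivProd.summable_iff.mpr hs
  refine (hs'.tsum_sigma' ?_).trans ?_
  · exact fun n => (hasSum_fintype _).summable
  unfold op
  refine tsum_congr fun n : ℕ => ?_
  simp only [Function.comp_apply]
  rw [tsum_fintype, PowerSeries.coeff_mul, Finset.sum_smul]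
  refine Eq.trans ?_ (Finset.sum_coe_sort (Finset.HasAntidiagonal.antidiagonal n)
    fun p : ℕ × ℕ => (PowerSeries.coeff p.1 c * PowerSeries.coeff p.2 d) •
      ((A.ε : R) ^ n * A.der^[n] f))
  refine Finset.sum_congr rfl fun p _ => ?_
  have : (p : ℕ × ℕ).1 + (p : ℕ × ℕ).2 = n := by
    exact Finset.HasAntidiagonal.mem_antidiagonal.mp p.2
  simp [this]

lemma op_comm (c d : PowerSeries ℚ) (f : R) : A.op c (A.op d f) = A.op d (A.op c f) := by
  rw [op_op, op_op, mul_comm]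

lemma op_one (f : R) : A.op 1 f = f := by
  unfold op
  rw [tsum_eq_single 0]
  · simp
  · intro n hn
    simp [PowerSeries.coeff_one, hn]

lemma op_X (f : R) : A.op PowerSeries.X f = A.ε * A.der f := by
  unfold op
  rw [tsum_eq_single 1]
  · simp
  · intro n hn
    simp [PowerSeries.coeff_X, hn]

lemma star_op (c : PowerSeries ℚ) (f : R) : star (A.op c f) = A.op c (star f) := by
  have h (n : ℕ) (f : R) : star (A.der^[n] f) = A.der^[n] (star f) := by
    induction n generalizing f with
    | zero => rfl
    | succ n ih => rw [Function.iterate_succ_apply, ih, ← A.der_star, Function.iterate_succ_apply]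
  unfold op
  refine ((A.summable_op c f).map_tsum (starRingEnd R) continuous_star).trans ?_
  refine tsum_congr fun n => ?_
  rw [map_rat_smul, map_mul, map_pow, starRingEnd_apply, starRingEnd_apply, A.star_eps, h]

/-! ### Shifts -/

/-- The power series `exp (m x / 2)`. -/
def expHalf (m : ℤ) : PowerSeries ℚ := PowerSeries.rescale ((m : ℚ) / 2) (PowerSeries.exp ℚ)

lemma op_expHalf (m : ℤ) (f : R) : A.op (expHalf m) f = A.shift m f := rfl

lemma expHalf_mul (m n : ℤ) : expHalf m * expHalf n = expHalf (m + n) := by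
  simp [expHalf, PowerSeries.exp_mul_exp_eq_exp_add, add_div]

lemma expHalf_zero : expHalf 0 = 1 := by
  simp [expHalf, PowerSeries.rescale_zero]

lemma shift_add_index (m n : ℤ) (f : R) : A.shift m (A.shift n f) = A.shift (m + n) f := by
  rw [← op_expHalf, ← op_expHalf, op_op, expHalf_mul, op_expHalf]

lemma shift_zero (f : R) : A.shift 0 f = f := by
  rw [← op_expHalf, expHalf_zero, op_one]

lemma der_iterate_mul (n : ℕ) (f g : R) : A.der^[n] (f * g) =
    ∑ p ∈ Finset.HasAntidiagonal.antidiagonal n, n.choose p.1 • (A.der^[p.1] f * A.der^[p.2] g) := by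
  induction n with
  | zero => simp
  | succ n ih =>
    rw [Finset.sum_antidiagonal_choose_succ_nsmul (fun i j => A.der^[i] f * A.der^[j] g) n]
    simp only [Function.iterate_succ_apply', ih, map_sum, map_nsmul, Derivation.leibniz,
      smul_eq_mul, smul_add, Finset.sum_add_distrib]
    rw [add_right_inj]
    refine Finset.sum_congr rfl fun p hp => ?_
    rw [n.choose_symm_of_eq_add (Finset.HasAntidiagonal.mem_antidiagonal.mp hp).symm, mul_comm]

/-- The coefficients are `(m/2)ⁿ/n!`, and the binomial coefficient accounts for the factorials. This
matches the Cauchy product with the Leibniz rule in `shift_mul`. -/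
lemma coeff_expHalf_mul (m : ℤ) (i j : ℕ) :
    PowerSeries.coeff i (expHalf m) * PowerSeries.coeff j (expHalf m) =
      PowerSeries.coeff (i + j) (expHalf m) * ((i + j).choose i : ℚ) := by
  have hc : ((i + j).choose i : ℚ) * i.factorial * j.factorial = (i + j).factorial := by
    exact_mod_cast Nat.choose_symm_add ▸ Nat.add_choose_mul_factorial_mul_factorial i j
  have h : ((i + j).factorial : ℚ) ≠ 0 := Nat.cast_ne_zero.mpr (i + j).factorial_ne_zero
  have hi : (i.factorial : ℚ) ≠ 0 := Nat.cast_ne_zero.mpr i.factorial_ne_zero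
  have hj : (j.factorial : ℚ) ≠ 0 := Nat.cast_ne_zero.mpr j.factorial_ne_zero
  simp only [expHalf, PowerSeries.coeff_rescale, PowerSeries.coeff_exp, Algebra.algebraMap_self,
    RingHom.id_apply, pow_add]
  field_simp
  linear_combination (-(m : ℚ) ^ i * m ^ j * (1 / 2) ^ i * (1 / 2) ^ j) * hc

/-- The exponential of a derivation is multiplicative: the Cauchy product of the two series agrees
degree by degree with the iterated Leibniz rule. -/
lemma shift_mul (m : ℤ) (f g : R) : A.shift m (f * g) = A.shift m f * A.shift m g := by
  have := nonarchimedeanRing_of_isLinearTopology R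
  simp only [← op_expHalf]
  have hf := A.summable_op (expHalf m) f
  have hg := A.summable_op (expHalf m) g
  have hfg := hf.mul_of_nonarchimedean hg
  have h := hf.tsum_mul_tsum_eq_tsum_sum_antidiagonal hg hfg
  unfold op
  rw [h]
  refine tsum_congr fun n => ?_
  rw [der_iterate_mul, Finset.mul_sum, Finset.smul_sum]
  refine Finset.sum_congr rfl fun p hp => ?_
  obtain rfl := Finset.HasAntidiagonal.mem_antidiagonal.mp hp
  rw [smul_mul_smul_comm, coeff_expHalf_mul, mul_smul, Nat.cast_smul_eq_nsmul ℚ, mul_smul_comm,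
    pow_add, mul_mul_mul_comm]

lemma shift_one (m : ℤ) : A.shift m 1 = 1 := by
  rw [← op_expHalf, A.op_of_der_eq_zero _ (Derivation.map_one_eq_zero _)]
  simp [expHalf]

/-- The shifts as ring homomorphisms. -/
def shiftHom (m : ℤ) : R →+* R where
  toFun := A.shift m
  map_one' := A.shift_one m
  map_mul' := A.shift_mul m
  map_zero' := A.op_zero _
  map_add' := A.op_add _

lemma shiftHom_apply (m : ℤ) (f : R) : A.shiftHom m f = A.shift m f := rfl

lemma shift_add (m : ℤ) (f g : R) : A.shift m (f + g) = A.shift m f + A.shift m g := A.op_add _ f g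

lemma shift_sub (m : ℤ) (f g : R) : A.shift m (f - g) = A.shift m f - A.shift m g := A.op_sub _ f g

lemma shift_of_der_eq_zero (m : ℤ) {f : R} (hf : A.der f = 0) : A.shift m f = f := by
  rw [← mul_one f, ← op_expHalf, A.op_const_mul _ hf, op_expHalf, shift_one]

lemma star_shift (m : ℤ) (f : R) : star (A.shift m f) = A.shift m (star f) := A.star_op _ f

lemma sinhc_eq : PowerSeries.X * sinhc = expHalf 1 - expHalf (-1) := by
  rw [X_mul_sinhc]
  simp [expHalf]

lemma eps_mul_nabla (f : R) : (A.ε : R) * A.nabla f = A.shift 1 f - A.shift (-1) f := by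
  rw [nabla, ← mul_assoc, Units.mul_inv, one_mul]

lemma eps_mul_nabla_eq_op (f : R) :
    (A.ε : R) * A.nabla f = A.op (PowerSeries.X * sinhc) f := by
  rw [eps_mul_nabla, sinhc_eq, op_series_sub, op_expHalf, op_expHalf]

/-- `P ∇ = ∂`. -/
lemma P_eps_mul_nabla (f : R) : A.P ((A.ε : R) * A.nabla f) = A.ε * A.der f := by
  rw [eps_mul_nabla_eq_op, P, op_op, mul_left_comm, mul_comm sinhc⁻¹, sinhc_mul_inv, mul_one, op_X]

/-- Applying `P` to `ε ∇ f = 0` gives `ε ∂ f = 0`, and `ε` is invertible; conversely shifts fix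
constants. -/
lemma nabla_eq_zero_iff (f : R) : A.shift 1 f = A.shift (-1) f ↔ A.der f = 0 := by
  constructor
  · intro h
    have h2 := A.P_eps_mul_nabla f
    rw [eps_mul_nabla, h, sub_self, P, op_zero] at h2
    simpa using h2.symm
  · intro h
    rw [A.shift_of_der_eq_zero _ h, A.shift_of_der_eq_zero _ h]

/-! ### Quantum integers. -/

/-- The power series `(exp (k x / 2) - exp (-k x / 2)) / (exp (x / 2) - exp (-x / 2))`, a
quantum integer. -/
def qInt (k : ℤ) : PowerSeries ℚ :=
  (PowerSeries.mk fun n => PowerSeries.coeff (n + 1) (expHalf k - expHalf (-k))) * sinhc⁻¹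

lemma qInt_spec (k : ℤ) : PowerSeries.X * sinhc * qInt k = expHalf k - expHalf (-k) := by
  rw [qInt, mul_comm _ sinhc⁻¹, ← mul_assoc, mul_assoc _ sinhc, sinhc_mul_inv, mul_one]
  ext n
  rcases n with _ | n
  · rw [PowerSeries.coeff_zero_X_mul]
    simp only [expHalf, map_sub, PowerSeries.coeff_rescale]
    simp
  · simp [PowerSeries.coeff_succ_X_mul]

/-- Rational power series form a domain, so identities between quantum integers may be checked after
multiplying by the common denominator. -/
lemma X_mul_sinhc_ne_zero : PowerSeries.X * sinhc ≠ 0 :=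
  mul_ne_zero PowerSeries.X_ne_zero (left_ne_zero_of_mul_eq_one sinhc_mul_inv)

/-- This twisted addition law is what makes the cocycle cyclic: the two exponentials are the shifts
produced by rotating a triple product. -/
lemma qInt_add (i j : ℤ) : qInt (i + j) = qInt i * expHalf j + qInt j * expHalf (-i) := by
  apply mul_left_cancel₀ X_mul_sinhc_ne_zero
  rw [qInt_spec, mul_add, ← mul_assoc, ← mul_assoc, qInt_spec, qInt_spec, sub_mul, sub_mul,
    expHalf_mul, expHalf_mul, expHalf_mul, expHalf_mul, add_comm j (-i), neg_add, add_comm (-j)]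
  ring

lemma qInt_zero : qInt 0 = 0 := by
  apply mul_left_cancel₀ X_mul_sinhc_ne_zero
  rw [qInt_spec]
  simp

lemma qInt_one : qInt 1 = 1 := by
  apply mul_left_cancel₀ X_mul_sinhc_ne_zero
  rw [qInt_spec, mul_one, sinhc_eq]

lemma qInt_neg (i : ℤ) : qInt (-i) = -qInt i := by
  apply mul_left_cancel₀ X_mul_sinhc_ne_zero
  rw [qInt_spec, mul_neg, qInt_spec]
  simp

/-- On constants the quantum integer acts as the ordinary one. The denominators `k` in the expansion
of `K` come from here. -/
lemma coeff_zero_qInt (k : ℤ) : PowerSeries.coeff 0 (qInt k) = k := by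
  have h := congrArg (PowerSeries.coeff 1) (qInt_spec k)
  have h0 : PowerSeries.coeff 0 sinhc = 1 := by
    simp [sinhc, PowerSeries.coeff_rescale, PowerSeries.coeff_exp]
    norm_num
  rw [mul_assoc, PowerSeries.coeff_succ_X_mul] at h
  rw [PowerSeries.coeff_zero_eq_constantCoeff] at h h0 ⊢
  rw [map_mul, h0, one_mul] at h
  rw [h]
  simp only [expHalf, map_sub, PowerSeries.coeff_rescale, PowerSeries.coeff_exp]
  push_cast
  simp
  ring

end DiffAlg

end Toda

/-! ### The ring of difference operators with finitely many positive powers. -/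

namespace Toda

lemma finsum_finsum_sub {M : Type*} [AddCommMonoid M] (U : ℤ → ℤ → M)
    (hU : (Function.support fun p : ℤ × ℤ => U p.1 p.2).Finite) :
    ∑ᶠ n, ∑ᶠ i, U i (n - i) = ∑ᶠ p : ℤ × ℤ, U p.1 p.2 := by
  let e : ℤ × ℤ ≃ ℤ × ℤ :=
    { toFun := fun p => (p.2, p.1 - p.2)
      invFun := fun p => (p.1 + p.2, p.1)
      left_inv := fun p => by simp
      right_inv := fun p => by simp }
  rw [← finsum_comp_equiv e, finsum_curry]
  · rfl
  · exact hU.preimage e.injective.injOn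

variable (R : Type*) [CommRing R]

/-- The difference operators with finitely many positive powers of `Λ`. -/
def minusSubmodule : Submodule R (ℤ → R) where
  carrier := {a | IsMinus a}
  zero_mem' := ⟨0, fun _ _ => rfl⟩
  add_mem' := by
    rintro a b ⟨N, hN⟩ ⟨M, hM⟩
    refine ⟨max N M, fun k hk => ?_⟩
    rw [Pi.add_apply, hN k (by omega), hM k (by omega), add_zero]
  smul_mem' := by
    rintro c a ⟨N, hN⟩
    exact ⟨N, fun k hk => by rw [Pi.smul_apply, hN k hk, smul_zero]⟩

variable {R}

lemma finite_triple {a b c : ℤ → R} (ha : IsMinus a) (hb : IsMinus b) (hc : IsMinus c) (n : ℤ) :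
    {p : ℤ × ℤ | a p.1 ≠ 0 ∧ b p.2 ≠ 0 ∧ c (n - p.1 - p.2) ≠ 0}.Finite := by
  obtain ⟨N, hN⟩ := ha
  obtain ⟨M, hM⟩ := hb
  obtain ⟨K, hK⟩ := hc
  refine ((Set.finite_Icc (n - K - M) N).prod (Set.finite_Icc (n - K - N) M)).subset ?_
  rintro ⟨i, j⟩ ⟨h1, h2, h3⟩
  have h1 := not_lt.mp fun h => h1 (hN _ h)
  have h2 := not_lt.mp fun h => h2 (hM _ h)
  have h3 := not_lt.mp fun h => h3 (hK _ h)
  simp only [Set.mem_prod, Set.mem_Icc]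
  omega

variable [Algebra ℚ R] [UniformSpace R]
    [IsUniformAddGroup R] [IsTopologicalRing R] [IsLinearTopology ℚ R] [CompleteSpace R]
    [T2Space R] [StarRing R] [ContinuousStar R] (A : DiffAlg R)

namespace DiffAlg

lemma isMinus_comp {a b : ℤ → R} (ha : IsMinus a) (hb : IsMinus b) : IsMinus (A.comp a b) := by
  obtain ⟨N, hN⟩ := ha
  obtain ⟨M, hM⟩ := hb
  exact ⟨N + M, fun k hk => A.comp_eq_zero hN hM hk⟩

lemma comp_single_left (p : R) (i : ℤ) (b : ℤ → R) (k : ℤ) :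
    A.comp (Pi.single i p) b k = A.shift (i - k) p * A.shift i (b (k - i)) := by
  unfold comp
  rw [finsum_eq_single _ i]
  · simp
  · intro j hj
    rw [Pi.single_eq_of_ne hj, shift_zero_right, zero_mul]

lemma comp_single_right (p : R) (i : ℤ) (b : ℤ → R) (k : ℤ) :
    A.comp b (Pi.single i p) k = A.shift (-i) (b (k - i)) * A.shift (k - i) p := by
  unfold comp
  rw [finsum_eq_single _ (k - i)]
  · simp
  · intro j hj
    rw [Pi.single_eq_of_ne (by omega), shift_zero_right, mul_zero]

/-- A normal form, indexed by the exponents of the first two factors, which the other bracketing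
shares; associativity is then immediate. -/
lemma comp_comp_left {a b c : ℤ → R} (ha : IsMinus a) (hb : IsMinus b) (hc : IsMinus c) (n : ℤ) :
    A.comp (A.comp a b) c n = ∑ᶠ p : ℤ × ℤ, A.shift (p.1 - n) (a p.1) *
      A.shift (p.1 + p.2 - n + p.1) (b p.2) * A.shift (p.1 + p.2) (c (n - p.1 - p.2)) := by
  rw [← finsum_finsum_sub (fun i j => A.shift (i - n) (a i) *
    A.shift (i + j - n + i) (b j) * A.shift (i + j) (c (n - i - j)))]
  · refine finsum_congr fun m => ?_
    have hf := A.comp_finite (Or.inl ⟨ha, hb⟩) m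
    rw [comp, ← shiftHom_apply, map_finsum _ hf,
      finsum_mul']
    · refine finsum_congr fun i => ?_
      rw [shiftHom_apply, shift_mul, shift_add_index, shift_add_index]
      rw [show m - n + (i - m) = i - n by ring, show i + (m - i) = m by ring,
        show n - i - (m - i) = n - m by ring]
    · refine Set.Finite.subset hf fun i hi => ?_
      contrapose! hi
      simp only [Function.mem_support, not_not] at hi ⊢
      rw [hi, map_zero]
  · refine (finite_triple ha hb hc n).subset fun p hp => ?_
    simp only [Function.mem_support] at hp
    refine ⟨?_, ?_, ?_⟩ <;> (intro h; simp [h, shift_zero_right] at hp)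

lemma comp_comp_right {a b c : ℤ → R} (ha : IsMinus a) (hb : IsMinus b) (hc : IsMinus c) (n : ℤ) :
    A.comp a (A.comp b c) n = ∑ᶠ p : ℤ × ℤ, A.shift (p.1 - n) (a p.1) *
      A.shift (p.1 + p.2 - n + p.1) (b p.2) * A.shift (p.1 + p.2) (c (n - p.1 - p.2)) := by
  rw [finsum_curry]
  · refine finsum_congr fun i => ?_
    have hf := A.comp_finite (Or.inl ⟨hb, hc⟩) (n - i)
    rw [comp, ← A.shiftHom_apply i, map_finsum _ hf,
      mul_finsum']
    · refine finsum_congr fun j => ?_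
      rw [shiftHom_apply, shift_mul, shift_add_index, shift_add_index,
        ← mul_assoc]
      rw [show i + (j - (n - i)) = i + j - n + i by ring]
    · refine Set.Finite.subset hf fun i hi => ?_
      contrapose! hi
      simp only [Function.mem_support, not_not] at hi ⊢
      rw [hi, map_zero]
  · refine (finite_triple ha hb hc n).subset fun p hp => ?_
    simp only [Function.mem_support] at hp
    refine ⟨?_, ?_, ?_⟩ <;> (intro h; simp [h, shift_zero_right] at hp)

lemma comp_assoc {a b c : ℤ → R} (ha : IsMinus a) (hb : IsMinus b) (hc : IsMinus c) :
    A.comp (A.comp a b) c = A.comp a (A.comp b c) :=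
  funext fun n => (A.comp_comp_left ha hb hc n).trans (A.comp_comp_right ha hb hc n).symm

lemma comp_add {a b c : ℤ → R} (ha : IsMinus a) (hb : IsMinus b) (hc : IsMinus c) :
    A.comp a (b + c) = A.comp a b + A.comp a c := by
  funext n
  rw [Pi.add_apply]
  unfold comp
  rw [← finsum_add_distrib (A.comp_finite (Or.inl ⟨ha, hb⟩) n)
    (A.comp_finite (Or.inl ⟨ha, hc⟩) n)]
  exact finsum_congr fun i => by rw [Pi.add_apply, shift_add, mul_add]

lemma add_comp {a b c : ℤ → R} (ha : IsMinus a) (hb : IsMinus b) (hc : IsMinus c) :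
    A.comp (a + b) c = A.comp a c + A.comp b c := by
  funext n
  rw [Pi.add_apply]
  unfold comp
  rw [← finsum_add_distrib (A.comp_finite (Or.inl ⟨ha, hc⟩) n)
    (A.comp_finite (Or.inl ⟨hb, hc⟩) n)]
  exact finsum_congr fun i => by rw [Pi.add_apply, shift_add, add_mul]

end DiffAlg

/-- The ring `Φ₋` of difference operators. -/
def Minus (_ : DiffAlg R) : Type _ := minusSubmodule R

namespace Minus

variable {A}

instance : AddCommGroup (Minus A) := inferInstanceAs (AddCommGroup (minusSubmodule R))

instance : Module R (Minus A) := inferInstanceAs (Module R (minusSubmodule R))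

/-- The operator with given coefficients. -/
def mk (a : ℤ → R) (ha : IsMinus a) : Minus A := (⟨a, ha⟩ : minusSubmodule R)

/-- The coefficients of an operator. -/
def coeff (a : Minus A) : ℤ → R := Subtype.val (p := (· ∈ minusSubmodule R)) a

instance : CoeFun (Minus A) fun _ => ℤ → R := ⟨coeff⟩

lemma isMinus (a : Minus A) : IsMinus a := Subtype.property (p := (· ∈ minusSubmodule R)) a

lemma coe_injective {a b : Minus A} (h : (a : ℤ → R) = b) : a = b :=
  Subtype.ext (p := (· ∈ minusSubmodule R)) h

@[ext] lemma ext {a b : Minus A} (h : ∀ n, a n = b n) : a = b := coe_injective (funext h)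

/-- The operator `p Λ ^ i`. -/
def single (i : ℤ) (p : R) : Minus A :=
  mk (Pi.single i p) ⟨i, fun k hk => Pi.single_eq_of_ne (by omega) _⟩

instance : Mul (Minus A) := ⟨fun a b => mk (A.comp a b) (A.isMinus_comp a.isMinus b.isMinus)⟩

instance : One (Minus A) := ⟨single 0 1⟩

lemma coe_single (i : ℤ) (p : R) : (single i p : Minus A) = (Pi.single i p : ℤ → R) := rfl

lemma one_def : (1 : Minus A) = single 0 1 := rfl

lemma coe_one : ((1 : Minus A) : ℤ → R) = Pi.single 0 1 := rfl

lemma coe_mul (a b : Minus A) : ((a * b : Minus A) : ℤ → R) = A.comp a b := rfl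

lemma coeff_add (a b : Minus A) (n : ℤ) : (a + b) n = a n + b n := rfl

lemma coeff_sub (a b : Minus A) (n : ℤ) : (a - b) n = a n - b n := rfl

lemma coeff_zero (n : ℤ) : (0 : Minus A) n = 0 := rfl

lemma coeff_smul (c : R) (a : Minus A) (n : ℤ) : (c • a) n = c * a n := rfl

lemma single_mul_apply (i : ℤ) (p : R) (b : Minus A) (k : ℤ) :
    (single i p * b : Minus A) k = A.shift (i - k) p * A.shift i (b (k - i)) :=
  A.comp_single_left p i b k

lemma mul_single_apply (i : ℤ) (p : R) (b : Minus A) (k : ℤ) :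
    (b * single i p : Minus A) k = A.shift (-i) (b (k - i)) * A.shift (k - i) p :=
  A.comp_single_right p i b k

instance : Ring (Minus A) where
  mul_assoc a b c := coe_injective (A.comp_assoc a.isMinus b.isMinus c.isMinus)
  left_distrib a b c := coe_injective (A.comp_add a.isMinus b.isMinus c.isMinus)
  right_distrib a b c := coe_injective (A.add_comp a.isMinus b.isMinus c.isMinus)
  one_mul a := by ext n; rw [one_def, single_mul_apply, A.shift_one, A.shift_zero, one_mul, sub_zero]
  mul_one a := by
    ext n; rw [one_def, mul_single_apply, A.shift_one, neg_zero, A.shift_zero, mul_one, sub_zero]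
  zero_mul a := by
    ext n
    rw [coe_mul]
    exact finsum_eq_zero_of_forall_eq_zero fun i => by rw [coeff_zero, A.shift_zero_right, zero_mul]
  mul_zero a := by
    ext n
    rw [coe_mul]
    exact finsum_eq_zero_of_forall_eq_zero fun i => by rw [coeff_zero, A.shift_zero_right, mul_zero]
  neg_add_cancel := neg_add_cancel
  zsmul := (· • ·)
  nsmul := (· • ·)
  zsmul_zero' := SubNegMonoid.zsmul_zero'
  zsmul_succ' := SubNegMonoid.zsmul_succ'
  zsmul_neg' := SubNegMonoid.zsmul_neg'
  nsmul_zero := AddMonoid.nsmul_zero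
  nsmul_succ := AddMonoid.nsmul_succ
  sub_eq_add_neg := sub_eq_add_neg

lemma mul_apply (a b : Minus A) (n : ℤ) :
    (a * b) n = ∑ᶠ i : ℤ, A.shift (i - n) (a i) * A.shift i (b (n - i)) := rfl

/-- The product shifts coefficients, so a coefficientwise scalar may be moved out when it is fixed
by all shifts; constants are. -/
lemma const_smul_mul {c : R} (hc : A.der c = 0) (a b : Minus A) : c • a * b = c • (a * b) := by
  ext n
  rw [coeff_smul, mul_apply, mul_apply, mul_finsum' _ _ (A.comp_finite (Or.inl ⟨a.isMinus, b.isMinus⟩) n)]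
  refine finsum_congr fun i => ?_
  rw [coeff_smul, A.shift_mul, A.shift_of_der_eq_zero _ hc, mul_assoc]

lemma mul_const_smul {c : R} (hc : A.der c = 0) (a b : Minus A) : a * c • b = c • (a * b) := by
  ext n
  rw [coeff_smul, mul_apply, mul_apply, mul_finsum' _ _ (A.comp_finite (Or.inl ⟨a.isMinus, b.isMinus⟩) n)]
  refine finsum_congr fun i => ?_
  rw [coeff_smul, A.shift_mul, A.shift_of_der_eq_zero _ hc, mul_left_comm]

/-- The derivation `ε ∂`, acting on coefficients. -/
def epsDer (a : Minus A) : Minus A := mk (fun n => (A.ε : R) * A.der (a n)) <| by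
  obtain ⟨N, hN⟩ := a.isMinus
  exact ⟨N, fun k hk => by beta_reduce; rw [hN k hk, map_zero, mul_zero]⟩

lemma epsDer_apply (a : Minus A) (n : ℤ) : epsDer a n = A.ε * A.der (a n) := rfl

/-- The derivation commutes with the shifts in the product, both being power series in `ε ∂`. -/
lemma epsDer_mul (a b : Minus A) : epsDer (a * b) = epsDer a * b + a * epsDer b := by
  ext n
  have hf := A.comp_finite (Or.inl ⟨a.isMinus, b.isMinus⟩) n
  rw [epsDer_apply, ← A.op_X, mul_apply, coeff_add, mul_apply, mul_apply,
    ← finsum_add_distrib (A.comp_finite (Or.inl ⟨(epsDer a).isMinus, b.isMinus⟩) n)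
      (A.comp_finite (Or.inl ⟨a.isMinus, (epsDer b).isMinus⟩) n),
    ← A.opHom_apply, AddMonoidHom.map_finsum _ hf]
  refine finsum_congr fun i => ?_
  rw [epsDer_apply, epsDer_apply, ← A.op_X, ← A.op_X, ← A.op_expHalf, ← A.op_expHalf,
    ← A.op_expHalf, ← A.op_expHalf, A.op_comm _ _ (a i), A.op_comm _ _ (b (n - i)), A.opHom_apply,
    A.op_X, A.op_X, A.op_X, Derivation.leibniz, smul_eq_mul, smul_eq_mul]
  ring

lemma epsDer_single_of_der_eq_zero (i : ℤ) {c : R} (hc : A.der c = 0) :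
    epsDer (single i c : Minus A) = 0 := by
  ext n
  rw [epsDer_apply, coe_single, coeff_zero]
  by_cases h : n = i
  · subst h; rw [Pi.single_eq_same, hc, mul_zero]
  · rw [Pi.single_eq_of_ne h, map_zero, mul_zero]

/-- The coefficient of `Λ ^ (n + 1)` in the commutator of `Λ` with `a` is `ε ∇ (a n)`. -/
lemma commute_Lam_iff (a : Minus A) :
    a * single 1 1 = single 1 1 * a ↔ ∀ n, A.der (a n) = 0 := by
  constructor
  · intro h n
    have h1 := congrArg (fun x : Minus A => x (n + 1)) h
    simp only [mul_single_apply, single_mul_apply, A.shift_one, mul_one, one_mul,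
      add_sub_cancel_right] at h1
    exact (A.nabla_eq_zero_iff _).mp h1.symm
  · intro h
    ext n
    rw [mul_single_apply, single_mul_apply, A.shift_one, A.shift_one, mul_one, one_mul]
    exact ((A.nabla_eq_zero_iff _).mpr (h _)).symm

lemma commute_single {a : Minus A} (h : ∀ n, A.der (a n) = 0) (m : ℤ) :
    a * single m 1 = single m 1 * a := by
  ext n
  rw [mul_single_apply, single_mul_apply, A.shift_one, A.shift_one, mul_one, one_mul,
    A.shift_of_der_eq_zero _ (h _), A.shift_of_der_eq_zero _ (h _)]

end Minus

end Toda

/-! ### The cyclic cocycle. -/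

namespace Toda

namespace Minus

variable {R : Type*} [CommRing R] [Algebra ℚ R] [UniformSpace R]
    [IsUniformAddGroup R] [IsTopologicalRing R] [IsLinearTopology ℚ R] [CompleteSpace R]
    [T2Space R] [StarRing R] [ContinuousStar R] {A : DiffAlg R}

open DiffAlg (qInt expHalf)

/-- The cocycle `∑ᵢ [i] (aᵢ b₋ᵢ)` on `Φ₋`, where `[i]` is the quantum integer, so that
`ε ∇ (cocycle a b)` is the constant coefficient of `[a, b]`. -/
def cocycle (a b : Minus A) : R := ∑ᶠ i : ℤ, A.op (qInt i) (a i * b (-i))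

lemma cocycle_finite (a b : Minus A) :
    (Function.support fun i : ℤ => A.op (qInt i) (a i * b (-i))).Finite := by
  obtain ⟨N, hN⟩ := a.isMinus
  obtain ⟨M, hM⟩ := b.isMinus
  refine (Set.finite_Icc (-M) N).subset fun i hi => ?_
  by_contra hc
  rw [Set.mem_Icc, not_and_or, not_le, not_le] at hc
  apply hi
  beta_reduce
  rcases hc with hc | hc
  · rw [hM (-i) (by omega), mul_zero, A.op_zero]
  · rw [hN i hc, zero_mul, A.op_zero]

lemma cocycle_term_finite (a b c : Minus A) :
    (Function.support fun p : ℤ × ℤ => A.op (qInt (p.1 + p.2))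
      (A.shift (-p.2) (a p.1) * A.shift p.1 (b p.2) * c (-p.1 - p.2))).Finite := by
  refine (finite_triple a.isMinus b.isMinus c.isMinus 0).subset fun p hp => ?_
  simp only [Function.mem_support] at hp
  refine ⟨?_, ?_, ?_⟩ <;>
    (intro h; try rw [zero_sub] at h
     simp [h, A.shift_zero_right, A.op_zero] at hp)

/-- Written as a sum over exponents `i`, `j` and `-i - j`, the trilinear form can be compared with
its cyclic rotations by reindexing. -/
lemma cocycle_mul_left (a b c : Minus A) :
    cocycle (a * b) c = ∑ᶠ p : ℤ × ℤ, A.op (qInt (p.1 + p.2))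
      (A.shift (-p.2) (a p.1) * A.shift p.1 (b p.2) * c (-p.1 - p.2)) := by
  rw [← finsum_finsum_sub (fun i j => A.op (qInt (i + j))
      (A.shift (-j) (a i) * A.shift i (b j) * c (-i - j))) (cocycle_term_finite a b c)]
  refine finsum_congr fun n => ?_
  have hf := A.comp_finite (Or.inl ⟨a.isMinus, b.isMinus⟩) n
  rw [mul_apply, finsum_mul' _ _ hf, ← A.opHom_apply, map_finsum]
  · refine finsum_congr fun i => ?_
    rw [A.opHom_apply, show -(n - i) = i - n by ring, show i + (n - i) = n by ring,
      show -i - (n - i) = -n by ring]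
  · refine Set.Finite.subset hf fun i hi => ?_
    contrapose! hi
    simp only [Function.mem_support, not_not] at hi ⊢
    rw [hi, zero_mul]

lemma cocycle_swap (a b : Minus A) : cocycle b a = -cocycle a b := by
  unfold cocycle
  rw [← finsum_neg_distrib, ← finsum_comp_equiv (Equiv.neg ℤ)]
  refine finsum_congr fun i => ?_
  rw [Equiv.neg_apply, DiffAlg.qInt_neg, A.op_series_neg, neg_neg, mul_comm]

lemma cocycle_cyclic (a b c : Minus A) :
    cocycle (a * b) c + cocycle (b * c) a + cocycle (c * a) b = 0 := by
  let e : ℤ × ℤ ≃ ℤ × ℤ :=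
    { toFun := fun p => (p.2, -p.1 - p.2)
      invFun := fun p => (-p.1 - p.2, p.1)
      left_inv := fun p => Prod.ext (by dsimp only; ring) rfl
      right_inv := fun p => Prod.ext rfl (by dsimp only; ring) }
  have h1 := cocycle_term_finite a b c
  have h2 := (cocycle_term_finite b c a).preimage (e.injective.injOn)
  have h3 := (cocycle_term_finite c a b).preimage ((e.trans e).injective.injOn)
  rw [cocycle_mul_left, cocycle_mul_left, cocycle_mul_left, ← finsum_comp_equiv e (f := fun p : ℤ × ℤ => A.op (qInt (p.1 + p.2))
      (A.shift (-p.2) (b p.1) * A.shift p.1 (c p.2) * a (-p.1 - p.2))),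
    ← finsum_comp_equiv (e.trans e) (f := fun p : ℤ × ℤ => A.op (qInt (p.1 + p.2))
      (A.shift (-p.2) (c p.1) * A.shift p.1 (a p.2) * b (-p.1 - p.2))),
    ← finsum_add_distrib h1 h2, ← finsum_add_distrib _ h3]
  · refine finsum_eq_zero_of_forall_eq_zero fun p => ?_
    obtain ⟨i, j⟩ := p
    have e1 : e (i, j) = (j, -i - j) := rfl
    have e2 : (e.trans e) (i, j) = (-i - j, i) := by
      exact Prod.ext rfl (show -j - (-i - j) = i by ring)
    rw [e1, e2]
    dsimp only
    -- Both rotated terms are shifts of `X`, by `j` and by `-i`. Their quantum integers are `[-i]`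
    -- and `[-j]`, so the sum vanishes by `qInt_add`.
    set X := A.shift (-j) (a i) * A.shift i (b j) * c (-i - j) with hX
    have hj : A.shift (-(-i - j)) (b j) * A.shift j (c (-i - j)) * a (-j - (-i - j)) =
        A.op (expHalf j) X := by
      rw [A.op_expHalf, hX, A.shift_mul, A.shift_mul, A.shift_add_index, A.shift_add_index,
        add_neg_cancel, A.shift_zero, show -j - (-i - j) = i by ring,
        show -(-i - j) = j + i by ring]
      ring
    have hi : A.shift (-i) (c (-i - j)) * A.shift (-i - j) (a i) * b (-(-i - j) - i) =
        A.op (expHalf (-i)) X := by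
      rw [A.op_expHalf, hX, A.shift_mul, A.shift_mul, A.shift_add_index, A.shift_add_index,
        neg_add_cancel, A.shift_zero, show -(-i - j) - i = j by ring, ← sub_eq_add_neg]
      ring
    rw [hi, hj, A.op_op, A.op_op, show j + (-i - j) = -i by ring, show -i - j + i = -j by ring,
      DiffAlg.qInt_neg, DiffAlg.qInt_neg, DiffAlg.qInt_add, A.op_series_add, neg_mul, neg_mul,
      A.op_series_neg, A.op_series_neg]
    ring
  · exact (h1.union h2).subset (Function.support_add _ _)

lemma cocycle_one_left (a : Minus A) : cocycle 1 a = 0 := by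
  refine finsum_eq_zero_of_forall_eq_zero fun i => ?_
  rw [coe_one]
  by_cases h : i = 0
  · subst h
    rw [DiffAlg.qInt_zero, ← sub_self 1, A.op_series_sub, sub_self]
  · rw [Pi.single_eq_of_ne h, zero_mul, A.op_zero]

lemma cocycle_add_left (a b c : Minus A) : cocycle (a + b) c = cocycle a c + cocycle b c := by
  unfold cocycle
  rw [← finsum_add_distrib (cocycle_finite a c) (cocycle_finite b c)]
  exact finsum_congr fun i => by rw [coeff_add, add_mul, A.op_add]

lemma cocycle_sub_left (a b c : Minus A) : cocycle (a - b) c = cocycle a c - cocycle b c := by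
  rw [eq_sub_iff_add_eq, ← cocycle_add_left, sub_add_cancel]

lemma cocycle_smul_left {r : R} (hr : A.der r = 0) (a b : Minus A) :
    cocycle (r • a) b = r * cocycle a b := by
  unfold cocycle
  rw [mul_finsum' _ _ (cocycle_finite a b)]
  exact finsum_congr fun i => by rw [coeff_smul, mul_assoc, A.op_const_mul _ hr]

lemma cocycle_single_right (a : Minus A) (k : ℤ) :
    cocycle a (single k 1) = A.op (qInt (-k)) (a (-k)) := by
  unfold cocycle
  rw [finsum_eq_single _ (-k)]
  · rw [coe_single, neg_neg, Pi.single_eq_same, mul_one]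
  · intro i hi
    rw [coe_single, Pi.single_eq_of_ne (by omega), mul_zero, A.op_zero]

lemma cocycle_single_right_of_der_eq_zero (a : Minus A) {k : ℤ} (h : A.der (a (-k)) = 0) :
    cocycle a (single k 1) = (-k : ℚ) • a (-k) := by
  rw [cocycle_single_right, A.op_of_der_eq_zero _ h, DiffAlg.coeff_zero_qInt, Int.cast_neg]

lemma cocycle_single_left (p : R) (k : ℤ) (a : Minus A) :
    cocycle (single k p) a = A.op (qInt k) (p * a (-k)) := by
  unfold cocycle
  rw [finsum_eq_single _ k]
  · rw [coe_single, Pi.single_eq_same]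
  · intro i hi
    rw [coe_single, Pi.single_eq_of_ne hi, zero_mul, A.op_zero]

/-- The cocycle bounds the constant coefficient of a commutator. -/
lemma eps_mul_nabla_cocycle (a b : Minus A) :
    (A.ε : R) * A.nabla (cocycle a b) = (a * b) 0 - (b * a) 0 := by
  have h1 := A.comp_finite (Or.inl ⟨a.isMinus, b.isMinus⟩) 0
  have h2 := (A.comp_finite (Or.inl ⟨b.isMinus, a.isMinus⟩) 0).preimage
    ((Equiv.neg ℤ).injective.injOn)
  rw [A.eps_mul_nabla_eq_op, ← A.opHom_apply, cocycle, map_finsum _ (cocycle_finite a b),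
    mul_apply, mul_apply, ← finsum_comp_equiv (Equiv.neg ℤ) (f := fun i : ℤ =>
      A.shift (i - 0) (b i) * A.shift i (a (0 - i))), ← finsum_sub_distrib h1 h2]
  refine finsum_congr fun i => ?_
  beta_reduce
  rw [A.opHom_apply, A.op_op, DiffAlg.qInt_spec, A.op_series_sub, A.op_expHalf, A.op_expHalf,
    A.shift_mul, A.shift_mul, Equiv.neg_apply, sub_zero, sub_zero, zero_sub, zero_sub, neg_neg,
    mul_comm (A.shift (-i) (b (-i)))]

lemma epsDer_cocycle (a b : Minus A) :
    (A.ε : R) * A.der (cocycle a b) = cocycle (epsDer a) b + cocycle a (epsDer b) := by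
  rw [← A.op_X, ← A.opHom_apply, cocycle, map_finsum _ (cocycle_finite a b), cocycle, cocycle,
    ← finsum_add_distrib (cocycle_finite _ _) (cocycle_finite _ _)]
  refine finsum_congr fun i => ?_
  rw [A.opHom_apply, A.op_comm, A.op_X, ← A.op_add, Derivation.leibniz, smul_eq_mul, smul_eq_mul,
    epsDer_apply, epsDer_apply]
  congr 1
  ring

/-- Conjugation by an invertible operator preserves the cocycle on commuting operators. -/
lemma cocycle_conj {u v a b : Minus A} (hvu : v * u = 1) (hab : a * b = b * a) :
    cocycle (u * a * v) (u * b * v) = cocycle a b := by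
  -- The first two identities trade the conjugated pair for the original one. The leftover terms
  -- contain `u`, `b * a` and `v`, and cancel by the third, whose last term `c(v u, b a)` vanishes
  -- because `v * u = 1`.
  have h1 := cocycle_cyclic (u * a) v (u * b * v)
  have h2 := cocycle_cyclic u a (b * v)
  have h3 := cocycle_cyclic u (b * a) v
  rw [show v * (u * b * v) = b * v by rw [← mul_assoc, ← mul_assoc, hvu, one_mul],
    show u * b * v * (u * a) = u * (b * a) by
      rw [mul_assoc (u * b), ← mul_assoc v, hvu, one_mul, mul_assoc]] at h1
  rw [show b * v * u = b by rw [mul_assoc, hvu, mul_one], ← mul_assoc, hab] at h2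
  rw [hvu, cocycle_one_left] at h3
  have h4 := cocycle_swap (u * a) (b * v)
  have h5 := cocycle_swap a b
  linear_combination h1 - h3 - h4 + h2 - h5

/-- The logarithmic derivative of `u` against a conjugate of a power of `Λ`. -/
lemma cocycle_epsDer_mul {u v : Minus A} (huv : u * v = 1) (hvu : v * u = 1) (k : ℤ) :
    cocycle (epsDer u * v) (u * single k 1 * v) =
      A.P ((u * single k 1 * v : Minus A) 0 - (single k 1 : Minus A) 0) := by
  have hone : epsDer (1 : Minus A) = 0 :=
    epsDer_single_of_der_eq_zero 0 (Derivation.map_one_eq_zero _)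
  have hv : epsDer v = -(v * epsDer u * v) := by
    have h := epsDer_mul v u
    rw [hvu, hone] at h
    calc epsDer v = epsDer v * (u * v) := by rw [huv, mul_one]
      _ = (epsDer v * u + v * epsDer u) * v - v * epsDer u * v := by noncomm_ring
      _ = _ := by rw [← h]; noncomm_ring
  set s : Minus A := single k 1 with hs
  have hsv : epsDer (s * v) = -(s * v * epsDer u * v) := by
    rw [epsDer_mul, hs, epsDer_single_of_der_eq_zero k (Derivation.map_one_eq_zero _), hv]
    noncomm_ring
  -- As `(s v) u = s`, the argument of `P` is the constant coefficient of `[u, s v]`, so `P` turns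
  -- it into `ε ∂ c(u, s v)`, to be expanded by the Leibniz rule.
  have h0 := eps_mul_nabla_cocycle u (s * v)
  rw [mul_assoc s v u, hvu, mul_one, ← mul_assoc] at h0
  rw [← h0, A.P_eps_mul_nabla, epsDer_cocycle, hsv]
  have h1 := cocycle_cyclic (epsDer u) v (u * s * v)
  have h2 := cocycle_cyclic u (s * v * epsDer u) v
  rw [hvu, cocycle_one_left] at h2
  rw [show v * (u * s * v) = s * v by rw [← mul_assoc, ← mul_assoc, hvu, one_mul]] at h1
  rw [show u * (s * v * epsDer u) = u * s * v * epsDer u by noncomm_ring] at h2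
  have h3 := cocycle_swap (epsDer u) (s * v)
  have h4 := cocycle_swap u (-(s * v * epsDer u * v))
  -- Additivity applied to an element and its negative serves to pull the sign out of the cocycle.
  have h5 := cocycle_add_left (s * v * epsDer u * v) (-(s * v * epsDer u * v)) u
  have h6 : cocycle (0 : Minus A) u = 0 := by
    rw [← sub_self (0 : Minus A), cocycle_sub_left, sub_self]
  rw [add_neg_cancel, h6] at h5
  linear_combination h1 - h3 - h2 - h4 - h5

end Minus

end Toda

/-! ### Undressing and the first constraint. -/

namespace Toda

variable {R : Type*} [CommRing R] [Algebra ℚ R] [UniformSpace R]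
    [IsUniformAddGroup R] [IsTopologicalRing R] [IsLinearTopology ℚ R] [CompleteSpace R]
    [T2Space R] [StarRing R] [ContinuousStar R] {A : DiffAlg R}

namespace Minus

lemma mul_eq_zero_of_lt {a b : Minus A} {N M : ℤ} (ha : ∀ k, N < k → a k = 0)
    (hb : ∀ k, M < k → b k = 0) {k : ℤ} (hk : N + M < k) : (a * b) k = 0 :=
  A.comp_eq_zero ha hb hk

lemma mul_apply_top {a b : Minus A} {N M : ℤ} (ha : ∀ k, N < k → a k = 0)
    (hb : ∀ k, M < k → b k = 0) :
    (a * b) (N + M) = A.shift (-M) (a N) * A.shift N (b M) := by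
  rw [mul_apply, finsum_eq_single _ N]
  · rw [sub_add_cancel_left, add_sub_cancel_left]
  · intro i hi
    rcases lt_or_gt_of_ne hi with h | h
    · rw [hb _ (by omega), A.shift_zero_right, mul_zero]
    · rw [ha _ h, A.shift_zero_right, zero_mul]

lemma coeff_sum {ι : Type*} (s : Finset ι) (f : ι → Minus A) (n : ℤ) :
    (∑ i ∈ s, f i) n = ∑ i ∈ s, f i n := by
  let φ : Minus A →+ R := AddMonoidHom.mk' (fun a => a n) fun a b => coeff_add a b n
  exact map_sum φ f s

end Minus

namespace Data

open Minus

variable (T : Data A)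

/-- The dressing operator as an element of the ring `Φ₋`. -/
def dressing : Minus A := Minus.mk T.W ⟨0, fun _ hk => T.W_of_pos hk⟩

/-- The inverse of the dressing operator. -/
def dressingInv : Minus A := Minus.mk T.Winv ⟨0, fun _ hk => T.Winv_of_pos hk⟩

lemma dressing_of_pos {k : ℤ} (hk : 0 < k) : T.dressing k = 0 := T.W_of_pos hk

lemma dressingInv_of_pos {k : ℤ} (hk : 0 < k) : T.dressingInv k = 0 := T.Winv_of_pos hk

/-- The recursion defining `winv` is the vanishing of the coefficient of `Λ ^ (-(k + 1))` in the
product. -/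
lemma dressing_mul_inv : T.dressing * T.dressingInv = 1 := by
  ext n
  rw [coe_one]
  rcases lt_trichotomy n 0 with hn | rfl | hn
  · obtain ⟨k, rfl⟩ := Int.eq_negSucc_of_lt_zero hn
    rw [Pi.single_eq_of_ne (by omega), mul_apply,
      -- The exponents run over `0, -1, …, -(k + 1)`. The two extreme terms are split off, since
      -- there one factor is the leading coefficient 1.
      finsum_eq_sum_of_support_subset (s := (Finset.range (k + 2)).image fun j : ℕ => -(j : ℤ)),
      Finset.sum_image (by intro i _ j _ h; simpa using h), Finset.sum_range_succ',
      Finset.sum_range_succ, Finset.sum_range]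
    · have h0 : T.dressing (-((0 : ℕ) : ℤ)) = 1 := rfl
      have h1 : T.dressingInv (Int.negSucc k - -((0 : ℕ) : ℤ)) = T.winv k := by
        rw [Nat.cast_zero, neg_zero, sub_zero]; rfl
      have h2 : T.dressing (-((k + 1 : ℕ) : ℤ)) = T.w k := rfl
      have h3 : T.dressingInv (Int.negSucc k - -((k + 1 : ℕ) : ℤ)) = 1 := by
        rw [show Int.negSucc k - -((k + 1 : ℕ) : ℤ) = 0 by omega]; rfl
      rw [h0, h1, h2, h3, A.shift_one, A.shift_one, one_mul, mul_one,
        show -((k + 1 : ℕ) : ℤ) - Int.negSucc k = 0 by omega, Nat.cast_zero, neg_zero,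
        A.shift_zero, A.shift_zero, winv]
      have h4 : ∀ i : Fin k, A.shift (-((i + 1 : ℕ) : ℤ) - Int.negSucc k)
          (T.dressing (-((i + 1 : ℕ) : ℤ))) * A.shift (-((i + 1 : ℕ) : ℤ))
          (T.dressingInv (Int.negSucc k - -((i + 1 : ℕ) : ℤ))) =
          A.shift ((k : ℤ) - i) (T.w i) * A.shift (-((i : ℤ) + 1)) (T.winv (k - 1 - i)) := by
        intro i
        have hi := i.2
        rw [show Int.negSucc k - -((i + 1 : ℕ) : ℤ) = Int.negSucc (k - 1 - i) by omega,
          show -((i + 1 : ℕ) : ℤ) - Int.negSucc k = (k : ℤ) - i by omega]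
        push_cast
        rfl
      rw [Finset.sum_congr rfl fun i _ => h4 i]
      ring
    · intro i hi
      rw [Finset.coe_image, Set.mem_image]
      refine ⟨(-i).toNat, ?_, ?_⟩
      · rw [Finset.coe_range, Set.mem_Iio]
        by_contra hc
        apply hi
        beta_reduce
        rw [T.dressingInv_of_pos (by omega), A.shift_zero_right, mul_zero]
      · by_contra hc
        apply hi
        beta_reduce
        rw [T.dressing_of_pos (by omega), A.shift_zero_right, zero_mul]
  · rw [Pi.single_eq_same]
    refine (mul_apply_top (N := 0) (M := 0) (fun k => T.dressing_of_pos)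
      (fun k => T.dressingInv_of_pos)).trans ?_
    rw [show T.dressing 0 = 1 from rfl, show T.dressingInv 0 = 1 from rfl, A.shift_one,
      A.shift_one, mul_one]
  · rw [Pi.single_eq_of_ne (by omega)]
    exact mul_eq_zero_of_lt (N := 0) (M := 0) (fun k => T.dressing_of_pos)
      (fun k => T.dressingInv_of_pos) (by omega)

/-- The right inverse is itself a dressing operator, with coefficients `winv`, so it has a right
inverse too, which must be the original operator. -/
lemma dressingInv_mul : T.dressingInv * T.dressing = 1 := by
  let T' : Data A := ⟨T.q, T.star_q, T.winv⟩
  have h : T.dressingInv = T'.dressing := by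
    ext n
    rcases n with (_ | n) | n <;> rfl
  have h2 : T.dressing = T'.dressingInv := by
    calc T.dressing = T.dressing * (T'.dressing * T'.dressingInv) := by
          rw [T'.dressing_mul_inv, mul_one]
      _ = T'.dressingInv := by rw [← mul_assoc, ← h, T.dressing_mul_inv, one_mul]
  rw [h, h2, T'.dressing_mul_inv]

/-- The power `L ^ m` as an element of `Φ₋`. -/
def laxPow (m : ℤ) : Minus A := T.dressing * single m 1 * T.dressingInv

lemma laxPow_apply (m n : ℤ) : T.laxPow m n = T.Lpow m n := rfl

/-- The operator `K` as an element of `Φ₋`. -/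
def opK : Minus A := single 1 1 + single 0 T.v + single (-1) T.q

lemma coe_opK : (T.opK : ℤ → R) = T.K := rfl

/-- The operator `ℓ` as an element of `Φ₋`. -/
def opEll : Minus A := epsDer T.dressing * T.dressingInv

lemma opEll_apply (n : ℤ) : T.opEll n = T.ell n := rfl

lemma opEll_of_nonneg {n : ℤ} (hn : 0 ≤ n) : T.opEll n = 0 := by
  refine mul_eq_zero_of_lt (N := -1) (M := 0) (fun k hk => ?_) (fun k => T.dressingInv_of_pos)
    (by omega)
  rw [epsDer_apply]
  rcases (show 0 ≤ k by omega).eq_or_lt with rfl | h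
  · rw [show T.dressing 0 = 1 from rfl, Derivation.map_one_eq_zero, mul_zero]
  · rw [T.dressing_of_pos h, map_zero, mul_zero]

lemma L_one : T.L 1 = 1 := by
  have h := mul_apply_top (a := T.dressing * single 1 1) (b := T.dressingInv) (N := 1) (M := 0)
    (fun k hk => by
      rw [mul_single_apply, T.dressing_of_pos (by omega), A.shift_zero_right, zero_mul])
    (fun k => T.dressingInv_of_pos)
  refine h.trans ?_
  rw [mul_single_apply, sub_self, show T.dressing 0 = 1 from rfl,
    show T.dressingInv 0 = 1 from rfl, A.shift_one, A.shift_one, A.shift_one, mul_one, mul_one,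
    A.shift_one]

/-- By the choice of `v`, `K` and `L` agree in nonnegative degrees, and `ℓ` has only negative ones
because the leading coefficient of `W` is constant. -/
lemma opK_sub_of_nonneg {n : ℤ} (hn : 0 ≤ n) :
    (T.opK - A.τ • T.opEll - T.laxPow 1) n = 0 := by
  rw [coeff_sub, coeff_sub, coeff_smul, T.opEll_of_nonneg hn, mul_zero, sub_zero, coe_opK]
  change T.K n - T.L n = 0
  simp only [K, Pi.add_apply]
  rw [Pi.single_eq_of_ne (show n ≠ -1 by omega), add_zero]
  rcases hn.eq_or_lt with rfl | hn
  · rw [Pi.single_eq_of_ne (by omega), Pi.single_eq_same, zero_add, v, sub_self]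
  · rw [Pi.single_eq_of_ne (show n ≠ 0 by omega), add_zero]
    rcases (show 1 ≤ n by omega).eq_or_lt with rfl | hn
    · rw [Pi.single_eq_same, L_one, sub_self]
    · rw [Pi.single_eq_of_ne (by omega), L, T.Lpow_eq_zero hn, sub_self]

/-- The operator `K - τ ℓ`, conjugated by the dressing operator. -/
def undressed : Minus A := T.dressingInv * (T.opK - A.τ • T.opEll) * T.dressing

lemma conj_undressed :
    T.dressing * T.undressed * T.dressingInv = T.opK - A.τ • T.opEll := by
  rw [undressed, mul_assoc, mul_assoc, T.dressing_mul_inv, mul_one, ← mul_assoc,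
    T.dressing_mul_inv, one_mul]

lemma conj_undressed_sub : T.dressing * (T.undressed - single 1 1) * T.dressingInv =
    T.opK - A.τ • T.opEll - T.laxPow 1 := by
  rw [mul_sub, sub_mul, conj_undressed, laxPow]

lemma undressed_eq_of_conj {X : Minus A} (h : T.dressing * X * T.dressingInv =
    T.opK - A.τ • T.opEll) : T.undressed = X := by
  rw [undressed, ← h, mul_assoc, mul_assoc, T.dressingInv_mul, mul_one, ← mul_assoc,
    T.dressingInv_mul, one_mul]

lemma undressed_sub_of_nonneg {n : ℤ} (hn : 0 ≤ n) : (T.undressed - single 1 1 : Minus A) n = 0 := by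
  have h : T.undressed - single 1 1 =
      T.dressingInv * (T.opK - A.τ • T.opEll - T.laxPow 1) * T.dressing := by
    rw [← conj_undressed_sub, mul_assoc, mul_assoc, T.dressingInv_mul, mul_one, ← mul_assoc,
      T.dressingInv_mul, one_mul]
  rw [h]
  refine mul_eq_zero_of_lt (N := -1) (M := 0) (fun k hk => ?_) (fun k => T.dressing_of_pos)
    (by omega)
  exact mul_eq_zero_of_lt (N := 0) (M := -1) (fun k => T.dressingInv_of_pos)
    (fun k hk => T.opK_sub_of_nonneg (by omega)) (by omega)

/-- Powers of `Λ` are killed by `∂`, so only the dressing operator and its inverse are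
differentiated. For `m = 1` this makes the right side of the constraint a commutator with `τ ℓ`. -/
lemma epsDer_laxPow (m : ℤ) :
    epsDer (T.laxPow m) = T.opEll * T.laxPow m - T.laxPow m * T.opEll := by
  have hone : epsDer (1 : Minus A) = 0 :=
    epsDer_single_of_der_eq_zero 0 (Derivation.map_one_eq_zero _)
  have hv : epsDer T.dressingInv = -(T.dressingInv * epsDer T.dressing * T.dressingInv) := by
    have h := epsDer_mul T.dressingInv T.dressing
    rw [T.dressingInv_mul, hone] at h
    calc epsDer T.dressingInv = epsDer T.dressingInv * (T.dressing * T.dressingInv) := by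
          rw [T.dressing_mul_inv, mul_one]
      _ = (epsDer T.dressingInv * T.dressing + T.dressingInv * epsDer T.dressing) * T.dressingInv -
          T.dressingInv * epsDer T.dressing * T.dressingInv := by noncomm_ring
      _ = _ := by rw [← h]; noncomm_ring
  have h1 : T.opEll * T.laxPow m = epsDer T.dressing * single m 1 * T.dressingInv := by
    calc T.opEll * T.laxPow m = epsDer T.dressing * (T.dressingInv * T.dressing) * single m 1 *
          T.dressingInv := by rw [opEll, laxPow]; noncomm_ring
      _ = _ := by rw [T.dressingInv_mul, mul_one]
  rw [h1, laxPow, epsDer_mul, epsDer_mul, hv,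
    epsDer_single_of_der_eq_zero m (Derivation.map_one_eq_zero _), opEll]
  noncomm_ring

lemma constraintL_iff_commute : T.ConstraintL ↔
    (T.opK - A.τ • T.opEll) * T.laxPow 1 = T.laxPow 1 * (T.opK - A.τ • T.opEll) := by
  have h1 : T.ConstraintL ↔
      T.opK * T.laxPow 1 - T.laxPow 1 * T.opK = A.τ • epsDer (T.laxPow 1) := by
    rw [Minus.ext_iff]
    refine forall_congr' fun n => ?_
    rw [coeff_smul, epsDer_apply, mul_left_comm A.τ, ← Units.inv_mul_eq_iff_eq_mul]
    rfl
  rw [h1, epsDer_laxPow, sub_mul, mul_sub, const_smul_mul A.der_tau, mul_const_smul A.der_tau, smul_sub,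
    sub_eq_sub_iff_add_eq_add, sub_eq_sub_iff_add_eq_add,
    add_comm (A.τ • (T.opEll * T.laxPow 1))]

lemma constraintL_iff : T.ConstraintL ↔ ∀ n, A.der (T.undressed n) = 0 := by
  rw [constraintL_iff_commute, ← commute_Lam_iff, ← conj_undressed, laxPow]
  set u := T.dressing
  set v := T.dressingInv
  have huv : u * v = 1 := T.dressing_mul_inv
  have hvu : v * u = 1 := T.dressingInv_mul
  have key (a b : Minus A) : u * a * v * (u * b * v) = u * (a * b) * v := by
    rw [mul_assoc (u * a), ← mul_assoc v, ← mul_assoc v, hvu, one_mul]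
    noncomm_ring
  have inj (a : Minus A) : v * (u * a * v) * u = a := by
    rw [← mul_assoc, ← mul_assoc, hvu, one_mul, mul_assoc, hvu, mul_one]
  rw [key, key]
  constructor
  · intro h
    rw [← inj (T.undressed * single 1 1), h, inj]
  · intro h
    rw [h]

/-- The quantum integers involved are `[1] = 1`, `[0] = 0` and `[-1] = -1`, so `v` drops out. -/
lemma cocycle_opK (a : Minus A) : cocycle T.opK a = a (-1) - T.q * a 1 := by
  rw [opK, cocycle_add_left, cocycle_add_left, cocycle_single_left, cocycle_single_left,
    cocycle_single_left, DiffAlg.qInt_neg, DiffAlg.qInt_one, A.op_series_neg, A.op_one, A.op_one,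
    DiffAlg.qInt_zero, ← sub_self 1, A.op_series_sub, sub_self, one_mul, neg_neg]
  ring

/-- This explains the definition of `z`, and requires no constraint. The condition on `k` makes the
constant coefficient of `Λ ^ k` vanish in `cocycle_epsDer_mul`. -/
lemma z_eq_cocycle {k : ℕ} (hk : 1 ≤ k) :
    T.z k = cocycle (T.opK - A.τ • T.opEll) (T.laxPow k) := by
  have h := cocycle_epsDer_mul T.dressing_mul_inv T.dressingInv_mul k
  rw [coe_single, Pi.single_eq_of_ne (by omega), sub_zero] at h
  rw [cocycle_sub_left, cocycle_smul_left A.der_tau, cocycle_opK]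
  change _ = _ - A.τ * cocycle (epsDer T.dressing * T.dressingInv) _
  rw [laxPow, h]
  rfl

/-- An operator with constant coefficients commutes with `Λ ^ k`, so the dressing can be removed
from both arguments of the cocycle. -/
lemma z_eq (h : ∀ n, A.der (T.undressed n) = 0) {k : ℕ} (hk : 1 ≤ k) :
    T.z k = (-k : ℚ) • T.undressed (-k) := by
  rw [T.z_eq_cocycle hk, ← conj_undressed, laxPow,
    cocycle_conj T.dressingInv_mul (commute_single h k), cocycle_single_right_of_der_eq_zero _ (h _),
    Int.cast_natCast]

/-- Conjugation of a negative operator with constant coefficients. -/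
lemma conj_eq_finsum {X : Minus A} (hX : ∀ n, A.der (X n) = 0) (hneg : ∀ n, 0 ≤ n → X n = 0)
    (n : ℤ) : (T.dressing * X * T.dressingInv) n =
      ∑ᶠ k : ℕ, X (-((k : ℤ) + 1)) * T.Lpow (-((k : ℤ) + 1)) n := by
  -- Powers `L ^ (-(k + 1))` with `k ≥ N` do not reach degree `n`. Hence `X` may be replaced by the
  -- finite sum `S`, the remainder having order at most `-N - 1 < n`.
  set N := (-n).toNat with hN
  set S : Minus A := ∑ k ∈ Finset.range N, X (-((k : ℤ) + 1)) • single (-((k : ℤ) + 1)) 1 with hS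
  have hrest : (T.dressing * (X - S) * T.dressingInv) n = 0 := by
    refine mul_eq_zero_of_lt (N := -(N : ℤ) - 1) (M := 0) (fun k hk => ?_)
      (fun k => T.dressingInv_of_pos) (by omega)
    refine mul_eq_zero_of_lt (N := 0) (M := -(N : ℤ) - 1) (fun k => T.dressing_of_pos)
      (fun m hm => ?_) (by omega)
    rw [coeff_sub, sub_eq_zero, hS, coeff_sum]
    by_cases h : 0 ≤ m
    · rw [hneg m h, Finset.sum_eq_zero]
      intro k _
      rw [coeff_smul, coe_single, Pi.single_eq_of_ne (by omega), mul_zero]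
    · rw [Finset.sum_eq_single (-m - 1).toNat]
      · have e : -(((-m - 1).toNat : ℤ) + 1) = m := by omega
        rw [e, coeff_smul, coe_single, Pi.single_eq_same, mul_one]
      · intro j _ hj
        rw [coeff_smul, coe_single, Pi.single_eq_of_ne (by omega), mul_zero]
      · intro h
        exact absurd (Finset.mem_range.mpr (by omega)) h
  have hsplit : T.dressing * X * T.dressingInv =
      T.dressing * S * T.dressingInv + T.dressing * (X - S) * T.dressingInv := by
    noncomm_ring
  rw [hsplit, coeff_add, hrest, add_zero, hS, Finset.mul_sum, Finset.sum_mul, coeff_sum,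
    finsum_eq_sum_of_support_subset (s := Finset.range N)]
  · refine Finset.sum_congr rfl fun k _ => ?_
    rw [mul_const_smul (hX _), const_smul_mul (hX _), coeff_smul]
    rfl
  · intro k hk
    rw [Finset.coe_range, Set.mem_Iio]
    by_contra hc
    apply hk
    beta_reduce
    rw [T.Lpow_eq_zero (by omega), mul_zero]

/-- The operator `X` is kept arbitrary to serve both implications: it is read off from `undressed`
when the constraint is given, and built from `z` when the expansion is given. -/
lemma identity_iff {X : Minus A} (hX : ∀ n, A.der (X n) = 0) (hneg : ∀ n, 0 ≤ n → X n = 0)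
    (hz : ∀ k : ℕ, X (-((k : ℤ) + 1)) = -(((k : ℚ) + 1)⁻¹ • T.z (k + 1))) :
    T.Identity ↔ T.undressed = single 1 1 + X := by
  have hser (n : ℤ) : (T.dressing * X * T.dressingInv) n = -T.zSeries n := by
    rw [T.conj_eq_finsum hX hneg, zSeries, ← finsum_neg_distrib]
    refine finsum_congr fun k => ?_
    rw [hz, neg_mul, smul_mul_assoc]
  have h1 : T.Identity ↔
      T.opK - A.τ • T.opEll - T.laxPow 1 = T.dressing * X * T.dressingInv := by
    rw [Minus.ext_iff]
    refine forall_congr' fun n => ?_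
    rw [hser, coeff_sub, coeff_sub, coeff_smul, coe_opK, opEll_apply]
    change _ ↔ T.K n - A.τ * T.ell n - T.L n = _
    constructor <;> intro h <;> linear_combination h
  rw [h1]
  constructor
  · intro h
    apply T.undressed_eq_of_conj
    rw [mul_add, add_mul, ← h, laxPow]
    abel
  · intro h
    rw [← conj_undressed_sub, h, add_sub_cancel_left]

/-- The first constraint says that `K - τ ℓ` is a series in `L` with constant coefficients, and
these are then given by `z`. -/
theorem constraintL_iff_identity :
    T.ConstraintL ↔ (∀ k : ℕ, 1 ≤ k → A.der (T.z k) = 0) ∧ T.Identity := by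
  rw [constraintL_iff]
  constructor
  · intro h
    refine ⟨fun k hk => ?_, ?_⟩
    · rw [T.z_eq h hk, Derivation.map_smul, h, smul_zero]
    · rw [T.identity_iff (X := T.undressed - single 1 1) _ fun n hn => T.undressed_sub_of_nonneg hn]
      · abel
      · intro k
        rw [coeff_sub, coe_single, Pi.single_eq_of_ne (by omega), sub_zero, T.z_eq h (by omega)]
        push_cast
        rw [← neg_smul, smul_smul]
        have : -((k : ℚ) + 1)⁻¹ * -((k : ℚ) + 1) = 1 := by
          rw [neg_mul_neg, inv_mul_cancel₀ (by positivity)]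
        rw [this, one_smul]
      · intro n
        rw [coeff_sub, map_sub, h, coe_single, zero_sub, neg_eq_zero]
        by_cases hn : n = 1
        · rw [hn, Pi.single_eq_same, Derivation.map_one_eq_zero]
        · rw [Pi.single_eq_of_ne hn, map_zero]
  · rintro ⟨hz, hid⟩
    let x : ℤ → R
      | Int.ofNat _ => 0
      | Int.negSucc k => -(((k : ℚ) + 1)⁻¹ • T.z (k + 1))
    have hx0 : ∀ n, 0 ≤ n → x n = 0 := fun n hn => by
      obtain ⟨k, rfl⟩ := Int.eq_ofNat_of_zero_le hn
      rfl
    let X : Minus A := Minus.mk x ⟨0, fun k hk => hx0 k hk.le⟩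
    have hX : ∀ n, A.der (X n) = 0 := by
      rintro (k | k)
      · exact map_zero _
      · change A.der (-(((k : ℚ) + 1)⁻¹ • T.z (k + 1))) = 0
        rw [map_neg, Derivation.map_smul, hz _ (by omega), smul_zero, neg_zero]
    have hXz (k : ℕ) : X (-((k : ℤ) + 1)) = -(((k : ℚ) + 1)⁻¹ • T.z (k + 1)) := rfl
    rw [T.identity_iff hX hx0 hXz] at hid
    intro n
    rw [hid, coeff_add, map_add, hX, coe_single, add_zero]
    by_cases hn : n = 1
    · rw [hn, Pi.single_eq_same, Derivation.map_one_eq_zero]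
    · rw [Pi.single_eq_of_ne hn, map_zero]

/-- Under the constraint `z k` is `-k` times a negative coefficient of `undressed`, and `k` is
invertible over `ℚ`; the nonnegative part is always `Λ`. -/
lemma constraintL_and_z_iff : (T.ConstraintL ∧ ∀ k : ℕ, 1 ≤ k → T.z k = 0) ↔
    T.undressed = single 1 1 := by
  have hconst : ∀ n, A.der ((single 1 1 : Minus A) n) = 0 := by
    intro n
    rw [coe_single]
    by_cases hn : n = 1
    · rw [hn, Pi.single_eq_same, Derivation.map_one_eq_zero]
    · rw [Pi.single_eq_of_ne hn, map_zero]
  rw [constraintL_iff]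
  constructor
  · rintro ⟨h, hz⟩
    rw [← sub_eq_zero]
    ext n
    rw [coeff_zero]
    rcases lt_or_ge n 0 with hn | hn
    · obtain ⟨k, rfl⟩ := Int.eq_negSucc_of_lt_zero hn
      have h1 := hz (k + 1) (by omega)
      rw [T.z_eq h (by omega)] at h1
      have h2 : -(((k + 1 : ℕ)) : ℚ) ≠ 0 := neg_ne_zero.mpr (Nat.cast_ne_zero.mpr k.succ_ne_zero)
      have h3 : T.undressed (Int.negSucc k) = 0 := by
        have := congrArg (fun r => (-(((k + 1 : ℕ)) : ℚ))⁻¹ • r) h1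
        beta_reduce at this
        rwa [smul_smul, inv_mul_cancel₀ h2, one_smul, smul_zero] at this
      rw [coeff_sub, h3, coe_single, Pi.single_eq_of_ne (by omega), sub_zero]
    · exact T.undressed_sub_of_nonneg hn
  · intro h
    have hc : ∀ n, A.der (T.undressed n) = 0 := by rwa [h]
    refine ⟨hc, fun k hk => ?_⟩
    rw [T.z_eq hc hk, h, coe_single, Pi.single_eq_of_ne (by omega), smul_zero]

end Data

end Toda

namespace Toda

variable {R : Type*} [CommRing R] [Algebra ℚ R] [UniformSpace R]
    [IsUniformAddGroup R] [IsTopologicalRing R] [IsLinearTopology ℚ R] [CompleteSpace R]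
    [T2Space R] [StarRing R] [ContinuousStar R] {A : DiffAlg R}

namespace Data

open Minus

variable (T : Data A)

/-! ### The conjugate constraint -/

/-- The element `q ^ [m]` for integral `m`. -/
def qZPow : ℤ → R
  | Int.ofNat k => T.qPow k
  | Int.negSucc k => Ring.inverse (T.qPow (k + 1))

lemma qZPow_neg_natCast (k : ℕ) : T.qZPow (-(k : ℤ)) = Ring.inverse (T.qPow k) := by
  rcases k with _ | k
  · change (1 : R) = Ring.inverse 1
    rw [Ring.inverse_one]
  · rfl

lemma conj_apply (a : ℤ → R) (n : ℤ) : T.conj a n = star (a (-n)) * T.qZPow (-n) := by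
  rcases n with k | k
  · rw [Int.ofNat_eq_natCast, qZPow_neg_natCast]
    rfl
  · rfl

lemma qPow_succ (k : ℕ) : T.qPow (k + 1) = A.shift k T.q * A.shift (-1) (T.qPow k) := rfl

/-- In `(q Λ⁻¹) ^ (k + 1)` a factor is taken off on the right, where the definition takes it off on
the left. -/
lemma qPow_succ' (k : ℕ) : T.qPow (k + 1) = A.shift 1 (T.qPow k) * A.shift (-k) T.q := by
  induction k with
  | zero => rw [qPow_succ, qPow]; simp [A.shift_one, A.shift_zero]
  | succ k ih =>
    have h1 := congrArg (A.shift (-1)) ih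
    have h2 := congrArg (A.shift 1) (T.qPow_succ k)
    rw [A.shift_mul, A.shift_add_index, A.shift_add_index, neg_add_cancel, A.shift_zero] at h1
    rw [A.shift_mul, A.shift_add_index, A.shift_add_index, add_neg_cancel, A.shift_zero] at h2
    rw [qPow_succ, h1, h2]
    push_cast
    rw [neg_add, add_comm (k : ℤ) 1, add_comm (-1) (-(k : ℤ))]
    ring

variable {T}

lemma isUnit_shift {x : R} (hx : IsUnit x) (m : ℤ) : IsUnit (A.shift m x) :=
  hx.map (A.shiftHom m)

lemma shift_inverse {x : R} (hx : IsUnit x) (m : ℤ) :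
    A.shift m (Ring.inverse x) = Ring.inverse (A.shift m x) := by
  obtain ⟨u, rfl⟩ := hx
  rw [Ring.inverse_unit]
  exact (Ring.inverse_unit (Units.map (A.shiftHom m).toMonoidHom u)).symm

lemma isUnit_qPow (hq : IsUnit T.q) (k : ℕ) : IsUnit (T.qPow k) := by
  induction k with
  | zero => exact isUnit_one
  | succ k ih => exact (isUnit_shift hq _).mul (isUnit_shift ih _)

lemma qZPow_succ (hq : IsUnit T.q) (m : ℤ) :
    T.qZPow (m + 1) = A.shift m T.q * A.shift (-1) (T.qZPow m) := by
  rcases m with k | k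
  · rfl
  · have hm : IsUnit (A.shift (Int.negSucc k) T.q) := isUnit_shift hq _
    rw [show Int.negSucc k + 1 = -(k : ℤ) by omega, qZPow_neg_natCast]
    change _ = _ * A.shift (-1) (Ring.inverse (T.qPow (k + 1)))
    -- For negative exponents the factor must come off on the opposite side, since here the power
    -- appears inverted.
    rw [shift_inverse (isUnit_qPow hq _), qPow_succ', A.shift_mul, A.shift_add_index,
      A.shift_add_index, neg_add_cancel, A.shift_zero, show -1 + -(k : ℤ) = Int.negSucc k by omega,
      Ring.mul_inverse_rev, ← mul_assoc, Ring.mul_inverse_cancel _ hm, one_mul]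

lemma qZPow_succ' (hq : IsUnit T.q) (m : ℤ) :
    T.qZPow (m + 1) = A.shift 1 (T.qZPow m) * A.shift (-m) T.q := by
  rcases m with k | k
  · exact T.qPow_succ' k
  · have hm : IsUnit (A.shift (-Int.negSucc k) T.q) := isUnit_shift hq _
    rw [show Int.negSucc k + 1 = -(k : ℤ) by omega, qZPow_neg_natCast]
    change _ = A.shift 1 (Ring.inverse (T.qPow (k + 1))) * _
    rw [shift_inverse (isUnit_qPow hq _), qPow_succ, A.shift_mul, A.shift_add_index,
      A.shift_add_index, add_neg_cancel, A.shift_zero,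
      show 1 + (k : ℤ) = -Int.negSucc k by omega,
      Ring.mul_inverse_rev, mul_assoc, Ring.inverse_mul_cancel _ hm, mul_one]

lemma shift_tau_eps_der (m : ℤ) (x : R) :
    A.shift m (A.τ * (A.ε * A.der x)) = A.τ * (A.ε * A.der (A.shift m x)) := by
  rw [← A.op_expHalf, A.op_const_mul _ A.der_tau, A.op_const_mul _ A.der_eps, A.op_der,
    A.op_expHalf]

/-- The logarithmic derivatives of the elements `q ^ [m]`. -/
lemma tau_eps_der_qZPow (hq : IsUnit T.q) {g : R}
    (hg : A.τ * (A.ε * A.der T.q) = T.q * (A.shift 1 g - A.shift (-1) g)) (m : ℤ) :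
    A.τ * (A.ε * A.der (T.qZPow m)) = T.qZPow m * (A.shift m g - A.shift (-m) g) := by
  have hshift (m : ℤ) : A.τ * (A.ε * A.der (A.shift m T.q)) =
      A.shift m T.q * (A.shift (m + 1) g - A.shift (m - 1) g) := by
    rw [← shift_tau_eps_der, hg, A.shift_mul, A.shift_sub, A.shift_add_index, A.shift_add_index,
      ← sub_eq_add_neg]
  have hpow (k : ℕ) : A.τ * (A.ε * A.der (T.qPow k)) =
      T.qPow k * (A.shift k g - A.shift (-k) g) := by
    induction k with
    | zero =>
      rw [qPow, Derivation.map_one_eq_zero, Nat.cast_zero, neg_zero, sub_self, mul_zero, mul_zero,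
        mul_zero]
    | succ k ih =>
      have h1 := congrArg (A.shift (-1)) ih
      rw [shift_tau_eps_der, A.shift_mul, A.shift_sub, A.shift_add_index, A.shift_add_index] at h1
      have h2 := hshift k
      rw [qPow_succ, Derivation.leibniz, smul_eq_mul, smul_eq_mul]
      push_cast
      rw [show -((k : ℤ) + 1) = -1 + -(k : ℤ) by ring]
      rw [show -1 + (k : ℤ) = k - 1 by ring] at h1
      -- The differences of shifts of `g` telescope: `(k + 1) - (k - 1)` from the new factor, `(k -
      -- 1) - (-k - 1)` from the old ones.
      linear_combination A.shift k T.q * h1 + A.shift (-1) (T.qPow k) * h2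
  rcases m with k | k
  · exact hpow k
  · change A.τ * (A.ε * A.der (Ring.inverse (T.qPow (k + 1)))) =
      Ring.inverse (T.qPow (k + 1)) * _
    -- Negative exponents follow by differentiating `x * x⁻¹ = 1`.
    have h1 := hpow (k + 1)
    have h2 := Ring.mul_inverse_cancel _ (isUnit_qPow hq (k + 1))
    have h3 := congrArg A.der h2
    rw [Derivation.leibniz, Derivation.map_one_eq_zero, smul_eq_mul, smul_eq_mul] at h3
    rw [show -Int.negSucc k = ((k + 1 : ℕ) : ℤ) by omega,
      show Int.negSucc k = -((k + 1 : ℕ) : ℤ) by omega]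
    set x := T.qPow (k + 1)
    set y := Ring.inverse x
    linear_combination (A.τ * A.ε * y) * h3 - y * y * h1 -
      (A.τ * A.ε * A.der y + y * (A.shift ((k + 1 : ℕ) : ℤ) g - A.shift (-((k + 1 : ℕ) : ℤ)) g)) * h2

/-- `K` has three terms, so no condition on `b` is needed. This covers conjugate operators, which
are bounded in the other direction and lie outside the ring `Minus`. -/
lemma comp_K_left (b : ℤ → R) (n : ℤ) : A.comp T.K b n =
    A.shift 1 (b (n - 1)) + A.shift (-n) T.v * b n +
      A.shift (-1 - n) T.q * A.shift (-1) (b (n + 1)) := by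
  unfold DiffAlg.comp
  rw [finsum_eq_sum_of_support_subset (s := {1, 0, -1})]
  · rw [Finset.sum_insert (by decide), Finset.sum_insert (by decide), Finset.sum_singleton]
    simp [K, A.shift_one, A.shift_zero, add_assoc]
  · intro i hi
    by_contra hc
    simp only [Finset.coe_insert, Finset.coe_singleton, Set.mem_insert_iff,
      Set.mem_singleton_iff, not_or] at hc
    apply hi
    simp [K, hc.1, hc.2.1, hc.2.2, A.shift_zero_right]

lemma comp_K_right (b : ℤ → R) (n : ℤ) : A.comp b T.K n =
    A.shift (-1) (b (n - 1)) + b n * A.shift n T.v +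
      A.shift 1 (b (n + 1)) * A.shift (n + 1) T.q := by
  unfold DiffAlg.comp
  rw [finsum_eq_sum_of_support_subset (s := {n - 1, n, n + 1})]
  · rw [Finset.sum_insert (by simp; omega), Finset.sum_insert (by simp), Finset.sum_singleton]
    simp [K, A.shift_one, A.shift_zero, add_assoc]
  · intro i hi
    by_contra hc
    simp only [Finset.coe_insert, Finset.coe_singleton, Set.mem_insert_iff,
      Set.mem_singleton_iff, not_or] at hc
    apply hi
    have h1 : n - i ≠ 1 := by omega
    have h2 : n - i ≠ 0 := by omega
    have h3 : n - i ≠ -1 := by omega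
    simp only [K, Pi.add_apply, Pi.single_eq_of_ne h1, Pi.single_eq_of_ne h2,
      Pi.single_eq_of_ne h3, add_zero, A.shift_zero_right, mul_zero]

/-- The commutator of `K` with a conjugate operator. -/
lemma comm_K_conj (hq : IsUnit T.q) (a : ℤ → R) (m : ℤ) :
    A.comm T.K (T.conj a) (-m) = T.qZPow m * (-star (A.comm T.K a m) +
      star (a m) * (A.shift m (T.v - star T.v) - A.shift (-m) (T.v - star T.v))) := by
  -- Conceptually `K̄ = K + v̄ - v` and conjugation reverses products, whence the sign and the term
  -- in `v - v̄`. The recursions for `q ^ [m]` express the neighbouring powers through `q ^ [m]`.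
  have h1 := qZPow_succ hq m
  have h1' := qZPow_succ' hq m
  have h2 := qZPow_succ hq (m - 1)
  have h2' := qZPow_succ' hq (m - 1)
  rw [sub_add_cancel] at h2 h2'
  simp only [DiffAlg.comm, Pi.sub_apply, comp_K_left, comp_K_right, conj_apply, star_sub, star_add,
    star_mul', A.star_shift, T.star_q, A.shift_mul, A.shift_sub]
  have e1 : -(-m - 1) = m + 1 := by ring
  have e2 : -(-m + 1) = m - 1 := by ring
  have e3 : -1 - -m = m - 1 := by ring
  have e4 : -m + 1 = -(m - 1) := by ring
  have e5 : -1 - m = -(m + 1) := by ring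
  rw [e1, e2, e3, neg_neg, e4, e5]
  have h3 := congrArg (A.shift 1) h1
  have h4 := congrArg (A.shift (-1)) h1'
  rw [A.shift_mul, A.shift_add_index, A.shift_add_index, add_neg_cancel, A.shift_zero,
    add_comm 1 m] at h3
  rw [A.shift_mul, A.shift_add_index, A.shift_add_index, neg_add_cancel, A.shift_zero,
    show -1 + -m = -(m + 1) by ring] at h4
  linear_combination A.shift 1 (star (a (m + 1))) * h3 -
    A.shift (-1) (star (a (m - 1))) * h2 - A.shift (-1) (star (a (m + 1))) * h4 +
    A.shift 1 (star (a (m - 1))) * h2'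

lemma constraintLbar_of_constraintL (hq : IsUnit T.q) (hL : T.ConstraintL)
    (h : A.τ * A.der T.q = T.q * A.nabla (T.v - star T.v)) : T.ConstraintLbar := by
  have hg : A.τ * (A.ε * A.der T.q) =
      T.q * (A.shift 1 (T.v - star T.v) - A.shift (-1) (T.v - star T.v)) := by
    rw [← A.eps_mul_nabla, mul_left_comm, h, mul_left_comm]
  intro n
  obtain ⟨m, rfl⟩ : ∃ m, n = -m := ⟨-n, (neg_neg n).symm⟩
  have h1 := hL m
  rw [Units.inv_mul_eq_iff_eq_mul] at h1 ⊢
  rw [Lbar, comm_K_conj hq, h1, conj_apply, neg_neg, Derivation.leibniz, smul_eq_mul, smul_eq_mul,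
    star_mul', star_mul', A.star_eps, A.star_tau, A.der_star]
  -- The sign from reversing the commutator cancels that of `star τ = -τ`; what is left is the
  -- derivative of `q ^ [m]`.
  linear_combination (-star (T.L m)) * tau_eps_der_qZPow hq hg m

lemma Lbar_zero : T.Lbar 0 = star T.v := by
  rw [Lbar, conj_apply]
  exact mul_one _

lemma Lbar_neg_one : T.Lbar (-1) = T.q := by
  rw [Lbar, conj_apply, neg_neg, L_one, star_one, one_mul]
  change A.shift ((0 : ℕ) : ℤ) T.q * A.shift (-1) 1 = T.q
  rw [Nat.cast_zero, A.shift_zero, A.shift_one, mul_one]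

lemma Lbar_of_lt {n : ℤ} (hn : n < -1) : T.Lbar n = 0 := by
  rw [Lbar, conj_apply, L, T.Lpow_eq_zero (by omega), star_zero, zero_mul]

/-- Taken at `Λ⁻¹`, the lowest power in `L̄`: there the outer terms of `K` contribute equally to
both products and only the commutator with `v` and the term `q [Λ⁻¹, v̄]` remain. -/
lemma tau_der_q_of_constraintLbar (h : T.ConstraintLbar) :
    A.τ * A.der T.q = T.q * A.nabla (T.v - star T.v) := by
  have h1 := h (-1)
  rw [Lbar_neg_one] at h1
  rw [← h1, DiffAlg.nabla, mul_left_comm, DiffAlg.comm, Pi.sub_apply, comp_K_left, comp_K_right,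
    Lbar_neg_one, Lbar_of_lt (show (-1 : ℤ) - 1 < -1 by omega), neg_add_cancel, Lbar_zero,
    A.shift_zero_right, A.shift_zero_right, neg_neg, sub_self, A.shift_zero, A.shift_sub,
    A.shift_sub]
  ring

theorem constraints_iff (hq : IsUnit T.q) : T.ConstraintL ∧ T.ConstraintLbar ↔
    A.τ * A.der T.q = T.q * A.nabla (T.v - star T.v) ∧
      (∀ k : ℕ, 1 ≤ k → A.der (T.z k) = 0) ∧ T.Identity := by
  rw [← constraintL_iff_identity]
  exact ⟨fun h => ⟨tau_der_q_of_constraintLbar h.2, h.1⟩,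
    fun h => ⟨h.2, constraintLbar_of_constraintL hq h.2 h.1⟩⟩

/-! ### The flows -/

variable (T)

lemma negPart_conj_Lpow_one : negPart (T.conj (T.Lpow (1 : ℕ))) = Pi.single (-1) T.q := by
  funext n
  rw [Nat.cast_one]
  change (if n < 0 then T.Lbar n else 0) = _
  rcases lt_trichotomy n (-1) with hn | rfl | hn
  · rw [Lbar_of_lt hn, ite_self, Pi.single_eq_of_ne (by omega)]
  · rw [Lbar_neg_one, Pi.single_eq_same, if_pos (by omega)]
  · rw [if_neg (by omega), Pi.single_eq_of_ne (by omega)]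

/-- The negative part of the Lax operator as an element of `Φ₋`. -/
def laxNeg : Minus A := Minus.mk (negPart (T.Lpow (1 : ℕ)))
  ⟨0, fun k hk => if_neg (by omega)⟩

lemma opK_sub_laxPow : T.opK - T.laxPow 1 = single (-1) T.q - T.laxNeg := by
  ext n
  rw [coeff_sub, coeff_sub, coe_opK, laxPow_apply, coe_single]
  change T.K n - T.L n = _ - (if n < 0 then T.Lpow (1 : ℕ) n else 0)
  rw [Nat.cast_one]
  change _ = _ - (if n < 0 then T.L n else 0)
  simp only [K, Pi.add_apply]
  rcases lt_or_ge n 0 with hn | hn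
  · rw [if_pos hn, Pi.single_eq_of_ne (show n ≠ 1 by omega),
      Pi.single_eq_of_ne (show n ≠ 0 by omega), zero_add, zero_add]
  · have h := T.opK_sub_of_nonneg hn
    rw [coeff_sub, coeff_sub, coeff_smul, T.opEll_of_nonneg hn, mul_zero, sub_zero, coe_opK] at h
    change T.K n - T.L n = 0 at h
    simp only [K, Pi.add_apply] at h
    rw [if_neg (by omega), h, Pi.single_eq_of_ne (show n ≠ -1 by omega), sub_zero]

/-- The first constraint with vanishing `z`, in terms of the flows of the dressing operator. -/
theorem constraintL_and_z_iff_flow : (T.ConstraintL ∧ ∀ k : ℕ, 1 ≤ k → T.z k = 0) ↔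
    ∀ n : ℤ, T.flow 1 (freeW n) - T.flowbar 1 (freeW n) = A.τ * A.der (T.W n) := by
  have h1 : (∀ n : ℤ, T.flow 1 (freeW n) - T.flowbar 1 (freeW n) = A.τ * A.der (T.W n)) ↔
      (single (-1) T.q - T.laxNeg) * T.dressing = A.τ • epsDer T.dressing := by
    rw [Minus.ext_iff]
    refine forall_congr' fun n => ?_
    have hf := T.flow_freeW 1 n
    have hb := T.flowbar_freeW 1 n
    rw [negPart_conj_Lpow_one] at hb
    rw [sub_mul, coeff_sub, coeff_smul, epsDer_apply, ← A.ε.isUnit.mul_right_inj]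
    change _ ↔ A.comp (Pi.single (-1) T.q) T.W n - A.comp (negPart (T.Lpow (1 : ℕ))) T.W n =
      A.τ * (A.ε * A.der (T.W n))
    constructor <;> intro h
    · linear_combination h - hf + hb
    · linear_combination h + hf - hb
  have h2 : T.undressed = single 1 1 ↔ T.opK - T.laxPow 1 = A.τ • T.opEll := by
    rw [sub_eq_iff_eq_add, ← sub_eq_iff_eq_add', ← conj_undressed]
    constructor
    · intro h
      rw [h, laxPow]
    · intro h
      exact T.undressed_eq_of_conj (by rw [← conj_undressed, h, laxPow])
  rw [constraintL_and_z_iff, h1, h2, opK_sub_laxPow, opEll]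
  -- Multiplication on the right by `W` or `W⁻¹` passes between the two forms, the constant `τ`
  -- moving freely.
  constructor
  · intro h
    rw [h, const_smul_mul A.der_tau, mul_assoc, T.dressingInv_mul, mul_one]
  · intro h
    rw [← const_smul_mul A.der_tau, ← h, mul_assoc, T.dressing_mul_inv, mul_one]

lemma der_coeffs (a : Coeffs A) : A.der (a : R) = 0 := by
  have hinv : A.der ((A.ε⁻¹ : Rˣ) : R) = 0 := by
    have h := congrArg A.der (A.ε.inv_mul)
    rw [Derivation.leibniz, A.der_eps, Derivation.map_one_eq_zero, smul_zero, zero_add,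
      smul_eq_mul] at h
    exact (Units.mul_right_eq_zero _).mp h
  refine Algebra.adjoin_induction (p := fun x _ => A.der x = 0) ?_ ?_ ?_ ?_ a.2
  · rintro x (rfl | rfl)
    · exact A.der_eps
    · exact hinv
  · exact fun r => Derivation.map_algebraMap _ r
  · intro x y _ _ hx hy
    rw [map_add, hx, hy, add_zero]
  · intro x y _ _ hx hy
    rw [Derivation.leibniz, hx, hy, smul_zero, smul_zero, add_zero]

lemma evol_finite (c : Gen × ℕ → R) (f : FreeAlg A) : (Function.support fun p : Gen × ℕ =>
    T.eval (MvPolynomial.pderiv p f) * c p).Finite := by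
  refine f.vars.finite_toSet.subset fun p hp => ?_
  by_contra h
  apply hp
  beta_reduce
  rw [MvPolynomial.pderiv_eq_zero_of_notMem_vars h, map_zero, zero_mul]

/-- The chain rule for the derivation of a polynomial in the generators and their derivatives. -/
lemma finsum_eval_pderiv (f : FreeAlg A) :
    ∑ᶠ p : Gen × ℕ, T.eval (MvPolynomial.pderiv p f) * A.der^[p.2 + 1] (T.genVal p.1) =
      A.der (T.eval f) := by
  classical
  set c : Gen × ℕ → R := fun p => A.der^[p.2 + 1] (T.genVal p.1) with hc
  induction f using MvPolynomial.induction_on with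
  | C a =>
    rw [finsum_eq_zero_of_forall_eq_zero]
    · rw [eval, MvPolynomial.aeval_C]
      exact (der_coeffs a).symm
    · intro p
      rw [MvPolynomial.pderiv_C, map_zero, zero_mul]
  | add f g hf hg =>
    rw [map_add, map_add, ← hf, ← hg, ← finsum_add_distrib (T.evol_finite c f) (T.evol_finite c g)]
    exact finsum_congr fun p => by rw [map_add, map_add, add_mul]
  | mul_X f i hf =>
    have hX : T.eval (MvPolynomial.X i) = A.der^[i.2] (T.genVal i.1) := MvPolynomial.aeval_X _ _
    have h1 := T.evol_finite c (MvPolynomial.X i)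
    have h2 := T.evol_finite c f
    have hsum : ∑ᶠ p : Gen × ℕ, T.eval (MvPolynomial.pderiv p (MvPolynomial.X i)) * c p = c i := by
      rw [finsum_eq_single _ i]
      · rw [MvPolynomial.pderiv_X_self, map_one, one_mul]
      · intro p hp
        rw [MvPolynomial.pderiv_X_of_ne hp.symm, map_zero, zero_mul]
    have h3 : (Function.support fun p : Gen × ℕ =>
        T.eval f * (T.eval (MvPolynomial.pderiv p (MvPolynomial.X i)) * c p)).Finite :=
      h1.subset (Function.support_mul_subset_right _ _)
    have h4 : (Function.support fun p : Gen × ℕ =>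
        T.eval (MvPolynomial.X i) * (T.eval (MvPolynomial.pderiv p f) * c p)).Finite :=
      h2.subset (Function.support_mul_subset_right _ _)
    have hleib : ∀ p : Gen × ℕ, T.eval (MvPolynomial.pderiv p (f * MvPolynomial.X i)) * c p =
        T.eval f * (T.eval (MvPolynomial.pderiv p (MvPolynomial.X i)) * c p) +
          T.eval (MvPolynomial.X i) * (T.eval (MvPolynomial.pderiv p f) * c p) := by
      intro p
      rw [Derivation.leibniz, smul_eq_mul, smul_eq_mul, map_add, map_mul, map_mul]
      ring
    rw [finsum_congr hleib, finsum_add_distrib h3 h4, ← mul_finsum' _ _ h1, ← mul_finsum' _ _ h2,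
      hsum, hf, map_mul, Derivation.leibniz, hX, smul_eq_mul, smul_eq_mul, hc]
    dsimp only
    rw [Function.iterate_succ_apply']

/-- Summing over all variables frees the index set from `f`, so that sums for different prescribed
values can be compared termwise. -/
lemma evol_eq_finsum (c : Gen → R) (f : FreeAlg A) : T.evol c f =
    ∑ᶠ p : Gen × ℕ, T.eval (MvPolynomial.pderiv p f) * A.der^[p.2] (c p.1) := by
  refine (finsum_eq_sum_of_support_subset _ fun p hp => ?_).symm
  by_contra h
  apply hp
  rw [MvPolynomial.pderiv_eq_zero_of_notMem_vars h, map_zero, zero_mul]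

/-- Two evolutionary derivations that differ by `τ ∂` on the generators do so everywhere. -/
lemma evol_sub_evol {c d : Gen → R} (h : ∀ g, c g - d g = A.τ * A.der (T.genVal g))
    (f : FreeAlg A) : T.evol c f - T.evol d f = A.τ * A.der (T.eval f) := by
  rw [← finsum_eval_pderiv, mul_finsum' _ _ (T.evol_finite _ f), evol_eq_finsum, evol_eq_finsum,
    ← finsum_sub_distrib (T.evol_finite (fun p => A.der^[p.2] (c p.1)) f)
      (T.evol_finite (fun p => A.der^[p.2] (d p.1)) f)]
  refine finsum_congr fun p => ?_
  rw [← mul_sub, ← iterate_map_sub, h, A.der_iterate_const_mul A.der_tau,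
    ← Function.iterate_succ_apply, mul_left_comm]

theorem constraints_and_z_iff_flow (hq : IsUnit T.q) :
    (T.ConstraintL ∧ T.ConstraintLbar ∧ ∀ k : ℕ, 1 ≤ k → T.z k = 0) ↔
      ∀ f : FreeAlg A, T.flow 1 f - T.flowbar 1 f = A.τ * A.der (T.eval f) := by
  have hv : T.Lpow (1 : ℕ) 0 = T.v := by rw [Nat.cast_one]; rfl
  constructor
  · rintro ⟨hL, hLbar, hz⟩ f
    have hw := (T.constraintL_and_z_iff_flow).mp ⟨hL, hz⟩
    have hw' (k : ℕ) : T.flowW 1 (Int.negSucc k) - T.flowbarW 1 (Int.negSucc k) =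
        A.τ * A.der (T.w k) := by
      have h := hw (Int.negSucc k)
      simpa only [freeW, flow, flowbar, evol_X, Function.iterate_zero, id, W] using h
    refine T.evol_sub_evol ?_ f
    rintro (_ | k | k)
    · change T.q * A.nabla (T.Lpow (1 : ℕ) 0) - T.q * A.nabla (star (T.Lpow (1 : ℕ) 0)) =
        A.τ * A.der T.q
      rw [tau_der_q_of_constraintLbar hLbar, hv, DiffAlg.nabla, DiffAlg.nabla, DiffAlg.nabla,
        A.shift_sub, A.shift_sub]
      ring
    · exact hw' k
    · change star (T.flowbarW 1 (Int.negSucc k)) - star (T.flowW 1 (Int.negSucc k)) =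
        A.τ * A.der (star (T.w k))
      -- Conjugation exchanges the two flows, and `star τ = -τ` restores the sign.
      have h := congrArg star (hw' k)
      rw [star_sub, star_mul', A.star_tau, ← A.der_star] at h
      linear_combination -h
  · intro h
    have hL := T.constraintL_and_z_iff_flow.mpr fun n => by rw [h, eval_freeW]
    refine ⟨hL.1, constraintLbar_of_constraintL hq hL.1 ?_, hL.2⟩
    -- The generator `q` yields the equation for `τ ∂ q`, which together with the first constraint
    -- gives the second.
    have hX := h (MvPolynomial.X (Gen.q, 0))
    rw [flow, flowbar, evol_X, evol_X, eval, MvPolynomial.aeval_X] at hX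
    change T.q * A.nabla (T.Lpow (1 : ℕ) 0) - T.q * A.nabla (star (T.Lpow (1 : ℕ) 0)) =
      A.τ * A.der T.q at hX
    rw [← hX, hv, DiffAlg.nabla, DiffAlg.nabla, DiffAlg.nabla, A.shift_sub, A.shift_sub]
    ring

end Data

end Toda

end

theorem mainTheorem1 {R : Type*} [CommRing R] [Algebra ℚ R] [UniformSpace R]
    [IsUniformAddGroup R] [IsTopologicalRing R] [IsLinearTopology ℚ R] [CompleteSpace R]
    [T2Space R] [StarRing R] [ContinuousStar R] (A : Toda.DiffAlg R) (T : Toda.Data A) :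
    (T.ConstraintL ↔ (∀ k : ℕ, 1 ≤ k → A.der (T.z k) = 0) ∧ T.Identity) ∧
    (IsUnit T.q →
      (T.ConstraintL ∧ T.ConstraintLbar ↔
        A.τ * A.der T.q = T.q * A.nabla (T.v - star T.v) ∧
          (∀ k : ℕ, 1 ≤ k → A.der (T.z k) = 0) ∧ T.Identity)) ∧
    ((T.ConstraintL ∧ ∀ k : ℕ, 1 ≤ k → T.z k = 0) ↔
      ∀ n : ℤ, T.flow 1 (Toda.Data.freeW n) - T.flowbar 1 (Toda.Data.freeW n) =
        A.τ * A.der (T.W n)) ∧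
    (IsUnit T.q →
      ((T.ConstraintL ∧ T.ConstraintLbar ∧ ∀ k : ℕ, 1 ≤ k → T.z k = 0) ↔
        ∀ f : Toda.Data.FreeAlg A, T.flow 1 f - T.flowbar 1 f = A.τ * A.der (T.eval f))) :=
  ⟨T.constraintL_iff_identity, Toda.Data.constraints_iff, T.constraintL_and_z_iff_flow,
    T.constraints_and_z_iff_flow⟩
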